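/- For a probability law $P$ on $\mathbb R$ with $\int|x|^3\,dP(x)<\infty$, let $\mu(P)$ denote its mean and $\sigma(P)$ its standard deviation. If $\sigma(P)>0$, let $\widetilde P$ be its standardization, that is, the image of $P$ under $x\mapsto (x-\mu(P))/\sigma(P)$, and let $\varrho(P)=\int|x|^3\,d\widetilde P(x)\ (\ge 1)$. For $\varrho\ge1$ put $$B(\varrho)=\sqrt{\tfrac12\varrho^2+\tfrac12\varrho\sqrt{\varrho^2+8}-2}.$$ For probability laws $P,Q$ on $\mathbb R$ let $$\zeta_3(P,Q)=\sup_f\left|\int f\,dP-\int f\,dQ\right|\in[0,\infty]$$ be the Zolotarev distance of order $3$, where the supremum is over all bounded $f\in C^2(\mathbb R,\mathbb R)$ with $|f''(x)-f''(y)|\le|x-y|$ for all $x,y\in\mathbb R$. **Theorem.** Let $n\ge1$ and let $P_1,\dots,P_n$ be probability laws on $\mathbb R$ with $\int|x|^3\,dP_i(x)<\infty$ and $\sigma_i=\sigma(P_i)>0$. Put $\varrho_i=\varrho(P_i)$, $\sigma=\bigl(\sum_{i=1}^n\sigma_i^2\bigr)^{1/2}$ and $Q_i=\tfrac12(\delta_{-\sigma_i}+\delta_{\sigma_i})$.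 Then $$\zeta_3\Bigl(\widetilde{P_1*\cdots*P_n}\,,\ \widetilde{Q_1*\cdots*Q_n}\Bigr)\ \le\ \frac1{6\sigma^3}\sum_{i=1}^n\sigma_i^3B(\varrho_i).$$ Equality holds whenever each $P_i$ is a two-point law (i.e. $P_i=p\,\delta_a+(1-p)\,\delta_b$ with $a\ne b$, $0<p<1$, where $a,b,p$ may depend on $i$) and the centred third moments $\int(x-\mu(P_i))^3\,dP_i(x)$ are all $\ge0$ or all $\le0$. -/

import Mathlib

open MeasureTheory

noncomputable section

namespace Zolotarev

/-- The mean `μ(P)`. -/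
def mean (P : Measure ℝ) : ℝ := ∫ x, x ∂P

/-- The standard deviation `σ(P)`. -/
def stdDev (P : Measure ℝ) : ℝ := √(ProbabilityTheory.variance id P)

/-- The class of laws with finite third absolute moment and strictly positive standard deviation. -/
structure MemP3 (P : Measure ℝ) : Prop where
  isProbabilityMeasure : IsProbabilityMeasure P
  integrable_abs_pow_three : Integrable (fun x : ℝ => |x| ^ 3) P
  stdDev_pos : 0 < stdDev P

/-- The standardization of `P`: its image under `x ↦ (x - μ(P)) / σ(P)`. -/
def standardize (P : Measure ℝ) : Measure ℝ :=
  P.map (fun x => (x - mean P) / stdDev P)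

/-- The standardized third absolute moment `ρ(P)`. -/
def rho (P : Measure ℝ) : ℝ := ∫ x, |x| ^ 3 ∂(standardize P)

/-- The third centred moment. -/
def centredThirdMoment (P : Measure ℝ) : ℝ := ∫ x, (x - mean P) ^ 3 ∂P

/-- The function `B(ρ)`, used for `ρ ≥ 1`, where the radicand is nonnegative. -/
def B (ρ : ℝ) : ℝ := √(ρ ^ 2 / 2 + ρ * √(ρ ^ 2 + 8) / 2 - 2)

/-- The convolution `P₀ ∗ (P₁ ∗ (⋯ ∗ Pₙ₋₁))`; the empty convolution is the point mass at `0`. -/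
def convFin : (n : ℕ) → (Fin n → Measure ℝ) → Measure ℝ
  | 0, _ => Measure.dirac 0
  | n + 1, P => Measure.conv (P 0) (convFin n (fun i => P i.succ))

/-- The symmetric law `(δ_{-s} + δ_s) / 2`. -/
def symmTwoPoint (s : ℝ) : Measure ℝ :=
  (2⁻¹ : ENNReal) • (Measure.dirac (-s) + Measure.dirac s)

/-- `P` is a two-point law: it charges exactly two distinct points. -/
def IsTwoPoint (P : Measure ℝ) : Prop :=
  ∃ a b p : ℝ, a ≠ b ∧ 0 < p ∧ p < 1 ∧
    P = ENNReal.ofReal p • Measure.dirac a + ENNReal.ofReal (1 - p) • Measure.dirac b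

/-- The bounded `C²` functions `f : ℝ → ℝ` whose second derivative is Lipschitz with constant at
most `1`. -/
def F3Bdd : Set (ℝ → ℝ) :=
  {f | ContDiff ℝ 2 f ∧ LipschitzWith 1 (iteratedDeriv 2 f) ∧ ∃ C : ℝ, ∀ x, |f x| ≤ C}

/-- The Zolotarev distance of order `3` between laws on the line, with values in `[0, ∞]`. -/
def zeta3 (P Q : Measure ℝ) : ENNReal :=
  ⨆ f ∈ F3Bdd, ENNReal.ofReal |(∫ x, f x ∂P) - ∫ x, f x ∂Q|

end Zolotarev

end

open Zolotarev

/-! ### Real-variable inequalities -/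

/-! Upper bound. The test class is invariant under translations and scales like a cube, so the
factors of the convolution can be exchanged one at a time (`abs_integral_convFin_sub_le`). What
remains is a standardized law `ν` against the symmetric law on `±1`, with bound `B ρ / 6`.

For that comparison, choose a knot `t ∈ [-1, 1]` at which both laws give `(x - t)₊ ^ 2` the same
integral (`exists_knot`). Both laws then agree on the span of `1, x, x ^ 2, (x - t)₊ ^ 2`. For an
interior knot, subtract from `|x - t| ^ 3 / 6 - f` its Hermite interpolant at `±1` in this span.
Since `f''` is `1`-Lipschitz, the remainder has a derivative concave left of `t` and convex right of
it, which forces the remainder to be nonnegative. Integration shows that `f` separates the laws no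
more than `|x - t| ^ 3 / 6` does. Knots at `±1` force one-sided support, where quadratics suffice.

Finally `∫ |x - t| ^ 3 ∂ν` is bounded by `1 + 3 t ^ 2 + B ρ`, where `1 + 3 t ^ 2` is the value for
the symmetric law. The tool is a majorant in `1, x, x ^ 2, |x| ^ 3` touching at the atoms of the
standardized two-point law with third absolute moment `ρ` (`exists_cubic_majorant`).

Equality. Rescaled sines approximate `x ^ 3 / 6` up to a linear term, so the distance is at least
one sixth of the difference of third moments. Centred third moments add under convolution and have
modulus `σ ^ 3 * B ρ` for two-point laws; a common sign prevents cancellation. -/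

theorem le_of_hasDerivAt_nonneg {G h : ℝ → ℝ} {a b : ℝ} (hG : ∀ x, HasDerivAt G (h x) x)
    (hab : a ≤ b) (hh : ∀ y, a < y → y < b → 0 ≤ h y) : G a ≤ G b := by
  have hdiff : Differentiable ℝ G := fun x => (hG x).differentiableAt
  refine monotoneOn_of_deriv_nonneg (convex_Icc a b) hdiff.continuous.continuousOn
    hdiff.differentiableOn (fun y hy => ?_) (Set.left_mem_Icc.2 hab) (Set.right_mem_Icc.2 hab) hab
  rw [interior_Icc] at hy
  rw [(hG y).deriv]
  exact hh y hy.1 hy.2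

theorem le_of_hasDerivAt_nonpos {G h : ℝ → ℝ} {a b : ℝ} (hG : ∀ x, HasDerivAt G (h x) x)
    (hab : a ≤ b) (hh : ∀ y, a < y → y < b → h y ≤ 0) : G b ≤ G a := by
  have := le_of_hasDerivAt_nonneg (fun x => (hG x).neg) hab fun y h1 h2 =>
    neg_nonneg.2 (hh y h1 h2)
  simpa using this

/-- Half of `nonneg_of_convexOn_deriv`: the case where the derivative is nonnegative at the knot. -/
theorem nonneg_of_convexOn_deriv_of_nonneg {G h : ℝ → ℝ} {t : ℝ} (ht : -1 < t) (ht' : t < 1)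
    (hG : ∀ x, HasDerivAt G (h x) x) (hconv : ConvexOn ℝ (Set.Ici t) h)
    (hconc : ConcaveOn ℝ (Set.Iic t) h) (h1 : h 1 = 0) (hm1 : h (-1) = 0)
    (G1 : G 1 = 0) (Gm1 : G (-1) = 0) (h0 : 0 ≤ h t) (x : ℝ) : 0 ≤ G x := by
  have hdiff : Differentiable ℝ G := fun x => (hG x).differentiableAt
  have mono := fun a b => le_of_hasDerivAt_nonneg (a := a) (b := b) hG
  have anti := fun a b => le_of_hasDerivAt_nonpos (a := a) (b := b) hG
  -- A concave `h` with `h (-1) = 0 ≤ h t` is nonnegative on `[-1, t]` and nonpositive before `-1`,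
  -- so on `(-∞, t]` the minimum of `G` is `G (-1) = 0`.
  have left : ∀ y, -1 ≤ y → y ≤ t → 0 ≤ h y := by
    intro y hy hy'
    rcases eq_or_lt_of_le hy with rfl | hy
    · exact hm1.ge
    rcases eq_or_lt_of_le hy' with rfl | hy'
    · exact h0
    have := hconc.neg.secant_mono_aux1 (x := -1) (y := y) (z := t) (by simp; linarith) (by simp)
      hy hy'
    simp only [Pi.neg_apply, hm1] at this
    nlinarith [mul_nonneg (sub_nonneg.2 hy.le) h0]
  have farleft : ∀ y, y ≤ -1 → h y ≤ 0 := by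
    intro y hy
    rcases eq_or_lt_of_le hy with rfl | hy
    · exact hm1.le
    have := hconc.neg.secant_mono_aux1 (x := y) (y := -1) (z := t) (by simp; linarith) (by simp)
      hy ht
    simp only [Pi.neg_apply, hm1] at this
    nlinarith [mul_nonneg (sub_nonneg.2 hy.le) h0]
  have Gt : 0 ≤ G t := Gm1 ▸ mono (-1) t ht.le fun y hy hy' => left y hy.le hy'.le
  rcases le_total x t with hx | hx
  · rcases le_total x (-1) with hx' | hx'
    · exact Gm1 ▸ anti x (-1) hx' fun y _ hy => farleft y hy.le
    · exact Gm1 ▸ mono (-1) x hx' fun y hy hy' => left y hy.le (hy'.le.trans hx)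
  -- By convexity and `h 1 = 0`, once `h` is nonpositive in `[t, 1)` it stays so up to `1`: there
  -- `G` first rises from `G t ≥ 0`, then falls to `G 1 = 0`.
  have neg : ∀ y z, t ≤ y → h y ≤ 0 → y < z → z < 1 → h z ≤ 0 := by
    intro y z hy hy' hyz hz
    have := hconv.secant_mono_aux1 (x := y) (y := z) (z := 1) (by simpa) (by simp; linarith) hyz hz
    rw [h1] at this
    nlinarith [mul_nonneg (sub_nonneg.2 hz.le) (neg_nonneg.2 hy')]
  rcases le_total x 1 with hx' | hx'
  · rcases le_or_gt (h x) 0 with hh | hh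
    · exact G1 ▸ anti x 1 hx' fun y hy hy' => neg x y hx hh hy hy'
    · refine Gt.trans (mono t x hx fun y hy hy' => ?_)
      by_contra hc
      have hx1 : x < 1 := lt_of_le_of_ne hx' (by rintro rfl; linarith)
      exact absurd (neg y x hy.le (not_le.1 hc).le hy' hx1) (not_le.2 hh)
  -- `G t ≥ 0 = G 1` gives a point of `(t, 1)` with `h ≤ 0`; convexity then makes `h` nonnegative
  -- beyond `1`.
  · obtain ⟨y, hy, hy'⟩ := exists_hasDerivAt_eq_slope G h ht' hdiff.continuous.continuousOn
      fun x _ => hG x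
    have hy0 : h y ≤ 0 := by
      rw [hy', G1]
      exact div_nonpos_of_nonpos_of_nonneg (by linarith) (by linarith)
    refine G1 ▸ mono 1 x hx' fun z hz _ => ?_
    have := hconv.secant_mono_aux1 (x := y) (y := 1) (z := z) (by simpa using hy.1.le)
      (by simp; linarith) hy.2 hz
    rw [h1] at this
    have : 0 ≤ (1 - y) * h z := by nlinarith [mul_nonneg (sub_nonneg.2 hz.le) (neg_nonneg.2 hy0)]
    exact nonneg_of_mul_nonneg_right this (by linarith [hy.2])

/-- A function vanishing to second order at `±1` whose derivative is concave to the left and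
convex to the right of some `t ∈ (-1, 1)` is nonnegative. -/
theorem nonneg_of_convexOn_deriv {G h : ℝ → ℝ} {t : ℝ} (ht : -1 < t) (ht' : t < 1)
    (hG : ∀ x, HasDerivAt G (h x) x) (hconv : ConvexOn ℝ (Set.Ici t) h)
    (hconc : ConcaveOn ℝ (Set.Iic t) h) (h1 : h 1 = 0) (hm1 : h (-1) = 0)
    (G1 : G 1 = 0) (Gm1 : G (-1) = 0) (x : ℝ) : 0 ≤ G x := by
  rcases le_total 0 (h t) with h0 | h0
  · exact nonneg_of_convexOn_deriv_of_nonneg ht ht' hG hconv hconc h1 hm1 G1 Gm1 h0 x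
  · have key := nonneg_of_convexOn_deriv_of_nonneg (G := fun x => G (-x)) (h := fun x => -h (-x))
      (t := -t) (by linarith) (by linarith)
      (fun x => by simpa [Function.comp_def] using (hG (-x)).scomp x (hasDerivAt_neg x)) ?_ ?_
      (by simp [hm1]) (by simp [h1]) Gm1 (by simpa) (by simpa) (-x)
    · simpa using key
    · have := hconc.comp_linearMap (-LinearMap.id)
      have hs : (-LinearMap.id : ℝ →ₗ[ℝ] ℝ) ⁻¹' Set.Iic t = Set.Ici (-t) := by
        ext y; simp [neg_le]
      rw [hs] at this
      exact this.neg
    · have := hconv.comp_linearMap (-LinearMap.id)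
      have hs : (-LinearMap.id : ℝ →ₗ[ℝ] ℝ) ⁻¹' Set.Ici t = Set.Iic (-t) := by
        ext y; simp [le_neg]
      rw [hs] at this
      exact this.neg

/-- A function with concave derivative on `(-∞, 1]`, vanishing to second order at `-1` and
vanishing at `1`, is nonnegative on `(-∞, 1]`. -/
theorem nonneg_of_concaveOn_deriv {G h : ℝ → ℝ} (hG : ∀ x, HasDerivAt G (h x) x)
    (hconc : ConcaveOn ℝ (Set.Iic 1) h) (hm1 : h (-1) = 0)
    (G1 : G 1 = 0) (Gm1 : G (-1) = 0) {x : ℝ} (hx : x ≤ 1) : 0 ≤ G x := by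
  have hdiff : Differentiable ℝ G := fun x => (hG x).differentiableAt
  have mono := fun a b => le_of_hasDerivAt_nonneg (a := a) (b := b) hG
  have anti := fun a b => le_of_hasDerivAt_nonpos (a := a) (b := b) hG
  obtain ⟨y, hy, hy'⟩ := exists_hasDerivAt_eq_slope G h (show (-1 : ℝ) < 1 by norm_num)
    hdiff.continuous.continuousOn fun x _ => hG x
  replace hy' : h y = 0 := by rw [hy', G1, Gm1]; simp
  have sec : ∀ a b c, a < b → b < c → c ≤ 1 →
      (b - a) * h c + (c - b) * h a ≤ (c - a) * h b := by
    intro a b c hab hbc hc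
    have := hconc.neg.secant_mono_aux1 (x := a) (y := b) (z := c) (by simp; linarith) (by simpa)
      hab hbc
    simp only [Pi.neg_apply] at this
    linarith
  rcases le_total x (-1) with hx1 | hx1
  · refine Gm1 ▸ anti x (-1) hx1 fun z _ hz => ?_
    have := sec z (-1) y hz hy.1 hy.2.le
    rw [hm1, hy'] at this
    have : (y + 1) * h z ≤ 0 := by linarith
    exact nonpos_of_mul_nonpos_right this (by linarith [hy.1])
  rcases le_total x y with hxy | hxy
  · refine Gm1 ▸ mono (-1) x hx1 fun z hz hz' => ?_
    have := sec (-1) z y hz (by linarith) hy.2.le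
    rw [hm1, hy'] at this
    exact nonneg_of_mul_nonneg_right (a := y - -1) (by linarith) (by linarith [hy.1])
  · refine G1 ▸ anti x 1 hx fun z hz hz' => ?_
    have := sec (-1) y z hy.1 (by linarith) hz'.le
    rw [hm1, hy'] at this
    have : (y + 1) * h z ≤ 0 := by linarith
    exact nonpos_of_mul_nonpos_right this (by linarith [hy.1])

/-- For `0 ≤ t ≤ c < 1`, the function `x ↦ |x - t| ^ 3` is dominated by a combination of
`1, x, x ^ 2, |x| ^ 3` that agrees with it at `-1 / c` and `c`. -/
theorem exists_cubic_majorant {c t : ℝ} (ht : 0 ≤ t) (htc : t ≤ c) (hc0 : 0 < c) (hc : c < 1) :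
    ∃ a b e l : ℝ, 0 ≤ l ∧ (∀ x, |x - t| ^ 3 ≤ a + b * x + e * x ^ 2 + l * |x| ^ 3) ∧
      a + e + l * (1 / c - c + 2 * c ^ 3 / (1 + c ^ 2)) =
        t ^ 3 + 3 * t + (1 / c - c) + 2 * (c - t) ^ 3 / (1 + c ^ 2) := by
  have hc2 : 0 < 1 - c ^ 2 := by nlinarith
  -- With `l = 1 + m`, the majorant minus `(t - x) ^ 3` on `x ≤ 0` must have a double zero at `-1 /
  -- c`, and minus `(x - t) ^ 3` on `x ≥ t` a double zero at `c`. These are four linear equations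
  -- for `a, b, e, m`, solved here with `S = a * (1 + c ^ 2) + 2 * m * c`. The signs of `a` and `m`
  -- make the cofactors of the squares nonnegative.
  set S : ℝ := (6 * t * c ^ 2 - 2 * t ^ 3) / (1 - c ^ 2) with hS
  set m : ℝ := 2 * c * (S - 3 * t ^ 2 * c + 2 * t ^ 3) / (1 + 4 * c ^ 2 + c ^ 4) with hm
  set a : ℝ := (S - 2 * m * c) / (1 + c ^ 2) with ha
  have hD : 0 < 1 + 4 * c ^ 2 + c ^ 4 := by positivity
  have tc2 : t ^ 2 ≤ c ^ 2 := by gcongr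
  have hSge : 6 * t * c ^ 2 - 2 * t ^ 3 ≤ S := by
    rw [hS, le_div_iff₀ hc2]
    have : 0 ≤ t * (6 * c ^ 2 - 2 * t ^ 2) := mul_nonneg ht (by nlinarith)
    nlinarith [mul_nonneg this (sq_nonneg c)]
  have hS0 : 0 ≤ S := by
    refine le_trans ?_ hSge
    nlinarith [mul_nonneg ht (sub_nonneg.2 tc2), mul_nonneg ht (sq_nonneg c)]
  have hm0 : 0 ≤ m := by
    refine div_nonneg (mul_nonneg (by positivity) ?_) hD.le
    have h1 : 0 ≤ t * c * (c - t) := by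
      have := sub_nonneg.2 htc
      positivity
    have h2 : S * (1 - c ^ 2) = 6 * t * c ^ 2 - 2 * t ^ 3 := by
      rw [hS]; field_simp
    by_contra hneg
    push Not at hneg
    have h3 : (S - 3 * t ^ 2 * c + 2 * t ^ 3) * (1 - c ^ 2) < 0 := mul_neg_of_neg_of_pos hneg hc2
    have h4 : 0 ≤ t * (t * c ^ 3) := by positivity
    have h5 : 0 ≤ t * c ^ 2 * (1 - t ^ 2) :=
      mul_nonneg (by positivity) (by nlinarith)
    nlinarith [mul_nonneg ht (sq_nonneg c)]
  have hmD : m * (1 + 4 * c ^ 2 + c ^ 4) = 2 * c * (S - 3 * t ^ 2 * c + 2 * t ^ 3) := by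
    rw [hm]; field_simp
  have hSD : S * (1 - c ^ 2) = 6 * t * c ^ 2 - 2 * t ^ 3 := by
    rw [hS]; field_simp
  have haD : a * (1 + c ^ 2) = S - 2 * m * c := by
    rw [ha]; field_simp
  have ha0 : 0 ≤ a := by
    refine div_nonneg ?_ (by positivity)
    have : (S - 2 * m * c) * (1 + 4 * c ^ 2 + c ^ 4) =
        S * (1 + c ^ 4) + 4 * c ^ 2 * t ^ 2 * (3 * c - 2 * t) := by
      linear_combination (-2 * c) * hmD
    refine nonneg_of_mul_nonneg_left (b := 1 + 4 * c ^ 2 + c ^ 4) ?_ hD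
    rw [this]
    have : 0 ≤ 3 * c - 2 * t := by linarith
    positivity
  clear_value a m S
  set b : ℝ := 2 * a * c - m / c ^ 2 with hb
  set e : ℝ := a * c ^ 2 - 2 * m / c with he
  have hbc : b * c ^ 2 = 2 * a * c ^ 3 - m := by rw [hb]; field_simp
  have hec : e * c = a * c ^ 3 - 2 * m := by rw [he]; field_simp
  clear_value b e
  have eb : b * c = 6 * t ^ 2 * c - 2 * (a + 2 * t ^ 3) + m * c ^ 3 := by
    refine mul_right_cancel₀ hc0.ne' ?_
    linear_combination hbc + 2 * c * haD - hmD
  have ee : e * c ^ 2 = a + 2 * t ^ 3 - 2 * m * c ^ 3 - 6 * t * c ^ 2 := by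
    linear_combination c * hec - (1 - c ^ 2) * haD - hSD
  refine ⟨a + t ^ 3, b - 3 * t ^ 2, e + 3 * t, 1 + m, by linarith, fun x => ?_, ?_⟩
  · rcases le_total x 0 with hx | hx
    · rw [abs_of_nonpos hx, abs_of_nonpos (by linarith)]
      have key : (a + b * x + e * x ^ 2 - m * x ^ 3) = (c * x + 1) ^ 2 * (a - m / c ^ 2 * x) := by
        field_simp
        linear_combination x * hbc + x ^ 2 * c * hec
      have : 0 ≤ (c * x + 1) ^ 2 * (a - m / c ^ 2 * x) :=
        mul_nonneg (sq_nonneg _) (by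
          have : 0 ≤ m / c ^ 2 * (-x) := mul_nonneg (by positivity) (by linarith)
          linarith)
      linarith
    have key : a + b * x + e * x ^ 2 + m * x ^ 3 + 6 * t * x ^ 2 - 6 * t ^ 2 * x + 2 * t ^ 3 =
        (1 - x / c) ^ 2 * (a + 2 * t ^ 3 + m * c ^ 2 * x) := by
      field_simp
      linear_combination x * c * eb + x ^ 2 * ee
    rcases le_total t x with hxt | hxt
    · rw [abs_of_nonneg hx, abs_of_nonneg (by linarith)]
      have : 0 ≤ (1 - x / c) ^ 2 * (a + 2 * t ^ 3 + m * c ^ 2 * x) := by positivity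
      linarith
    -- On `[0, t]` the gap is the right-hand expression minus `2 * (t - x) ^ 3`. Since `t ≤ c`, `t -
    -- x ≤ t * (1 - x / c)`, so the term `2 * t ^ 3` in the cofactor pays for it.
    · rw [abs_of_nonneg hx, abs_of_nonpos (by linarith)]
      have h1 : (1 - x / c) ^ 2 * (2 * t ^ 3) ≤
          (1 - x / c) ^ 2 * (a + 2 * t ^ 3 + m * c ^ 2 * x) := by
        refine mul_le_mul_of_nonneg_left ?_ (sq_nonneg _)
        have : 0 ≤ m * c ^ 2 * x := by positivity
        linarith
      have h2 : t - x ≤ t * (1 - x / c) := by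
        have : t * (x / c) ≤ x := by
          rw [← mul_div_assoc, div_le_iff₀ hc0]; nlinarith
        linarith
      have h3 : (t - x) ^ 2 ≤ (t * (1 - x / c)) ^ 2 := by
        have := sub_nonneg.2 hxt
        gcongr
      have h4 : 2 * (t - x) ^ 3 ≤ (1 - x / c) ^ 2 * (2 * t ^ 3) := by
        calc 2 * (t - x) ^ 3 = 2 * ((t - x) ^ 2 * (t - x)) := by ring
          _ ≤ 2 * ((t * (1 - x / c)) ^ 2 * t) := by
            have := sub_nonneg.2 hxt
            gcongr; linarith
          _ = _ := by ring
      nlinarith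
  · have hae : a + e = (-m + c * (2 * (c - t) ^ 3 - (2 + m) * c ^ 3)) / (c * (1 + c ^ 2)) := by
      rw [eq_div_iff (by positivity)]
      linear_combination hec - hbc + c * (eb + ee)
    have : a + t ^ 3 + (e + 3 * t) = (a + e) + t ^ 3 + 3 * t := by ring
    rw [this, hae]
    field_simp
    ring

/-- The function `B` in the parametrization `ρ = R - 2 / R`. -/
theorem B_sub_two_div {R : ℝ} (hR : 0 < R) : B (R - 2 / R) = √(R ^ 2 - 4) := by
  have h : √((R - 2 / R) ^ 2 + 8) = R + 2 / R := by
    rw [Real.sqrt_eq_iff_mul_self_eq (by positivity) (by positivity)]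
    field_simp
    ring
  rw [B, h]
  congr 1
  field_simp
  ring

/-- For `ρ > 1` there is a standardized two-point law, supported on `-1 / c` and `c`, with third
absolute moment `ρ`; its third absolute centred moment is `B ρ`. -/
theorem exists_two_point_parameter {ρ : ℝ} (hρ : 1 < ρ) :
    ∃ c : ℝ, 0 < c ∧ c < 1 ∧ ρ = 1 / c - c + 2 * c ^ 3 / (1 + c ^ 2) ∧ B ρ = 1 / c - c := by
  set s := √(ρ ^ 2 + 8) with hs
  have hss : s ^ 2 = ρ ^ 2 + 8 := Real.sq_sqrt (by positivity)
  have hs3 : 3 < s := by rw [hs, Real.lt_sqrt (by norm_num)]; nlinarith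
  -- `R` is the positive root of `R ^ 2 = ρ * R + 2`, and `c < 1` will be the smaller root of `c + 1
  -- / c = R`, so that `b = 1 / c - c`.
  set R := (ρ + s) / 2 with hR
  have hR2 : 2 < R := by rw [hR]; linarith
  have hρR : ρ = R - 2 / R := by
    have : R * R = ρ * R + 2 := by rw [hR]; nlinarith
    field_simp
    linarith
  have hRB : B ρ = √(R ^ 2 - 4) := by rw [hρR, B_sub_two_div (by linarith)]
  set b := √(R ^ 2 - 4) with hb
  have hbb : b ^ 2 = R ^ 2 - 4 := Real.sq_sqrt (by nlinarith)
  have hb0 : 0 < b := Real.sqrt_pos.2 (by nlinarith)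
  have hbR : b < R := by nlinarith
  have hinv : 1 / ((R - b) / 2) = (R + b) / 2 := by
    have : R - b ≠ 0 := by linarith
    field_simp
    nlinarith
  refine ⟨(R - b) / 2, by linarith, ?_, ?_, ?_⟩
  · nlinarith
  · rw [hinv]
    set c := (R - b) / 2 with hc
    have hc2 : c ^ 2 + 1 = R * c := by rw [hc]; nlinarith
    have hc0 : 0 < c := by rw [hc]; linarith
    have : 2 * c ^ 3 / (1 + c ^ 2) = 2 * c ^ 2 / R := by
      rw [add_comm, hc2]; field_simp
    rw [this, hρR]
    have h2 : c ^ 2 = R * c - 1 := by linarith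
    have h3 : (R + b) / 2 = R - c := by rw [hc]; ring
    rw [h2, h3]
    field_simp
    ring
  · rw [hinv, hRB]; ring

/-! ### The function class -/

theorem F3Bdd_hasDerivAt {f : ℝ → ℝ} (hf : f ∈ F3Bdd) (x : ℝ) :
    HasDerivAt f (deriv f x) x :=
  (hf.1.differentiable (by norm_num) x).hasDerivAt

theorem F3Bdd_hasDerivAt_deriv {f : ℝ → ℝ} (hf : f ∈ F3Bdd) (x : ℝ) :
    HasDerivAt (deriv f) (iteratedDeriv 2 f x) x := by
  have h2 : ContDiff ℝ (1 + 1) f := hf.1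
  have h1 : Differentiable ℝ (deriv f) :=
    (contDiff_succ_iff_deriv.1 h2).2.2.differentiable (by norm_num)
  rw [iteratedDeriv_succ, iteratedDeriv_one]
  exact (h1 x).hasDerivAt

theorem F3Bdd_iteratedDeriv_sub_le {f : ℝ → ℝ} (hf : f ∈ F3Bdd) (x y : ℝ) :
    |iteratedDeriv 2 f x - iteratedDeriv 2 f y| ≤ |x - y| := by
  simpa [Real.dist_eq] using hf.2.1.dist_le_mul x y

theorem mem_F3Bdd_of_hasDerivAt {f f' f'' : ℝ → ℝ} (h : ∀ x, HasDerivAt f (f' x) x)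
    (h' : ∀ x, HasDerivAt f' (f'' x) x) (hL : ∀ x y, |f'' x - f'' y| ≤ |x - y|)
    (hb : ∃ C, ∀ x, |f x| ≤ C) : f ∈ F3Bdd := by
  have e1 : deriv f = f' := funext fun x => (h x).deriv
  have e2 : deriv f' = f'' := funext fun x => (h' x).deriv
  have hlip : LipschitzWith 1 f'' :=
    LipschitzWith.of_dist_le_mul fun x y => by simpa [Real.dist_eq] using hL x y
  refine ⟨?_, ?_, hb⟩
  · have : ContDiff ℝ (1 + 1) f := by
      refine contDiff_succ_iff_deriv.2 ⟨fun x => (h x).differentiableAt, by simp, ?_⟩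
      rw [e1, contDiff_one_iff_deriv, e2]
      exact ⟨fun x => (h' x).differentiableAt, hlip.continuous⟩
    exact this
  · rw [iteratedDeriv_succ, iteratedDeriv_one, e1, e2]
    exact hlip

theorem F3Bdd_neg {f : ℝ → ℝ} (hf : f ∈ F3Bdd) : (fun x => -f x) ∈ F3Bdd := by
  refine mem_F3Bdd_of_hasDerivAt (fun x => (F3Bdd_hasDerivAt hf x).neg)
    (fun x => (F3Bdd_hasDerivAt_deriv hf x).neg) (fun x y => ?_) ?_
  · rw [← abs_neg]
    convert F3Bdd_iteratedDeriv_sub_le hf x y using 2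
    ring
  · obtain ⟨C, hC⟩ := hf.2.2
    exact ⟨C, fun x => by simpa using hC x⟩

/-- The class is stable under affine changes of variable, suitably normalized. -/
theorem F3Bdd_comp_affine {f : ℝ → ℝ} (hf : f ∈ F3Bdd) {s : ℝ} (hs : s ≠ 0) (z : ℝ) :
    (fun x => (|s| ^ 3)⁻¹ * f (s * x + z)) ∈ F3Bdd := by
  have hd : ∀ x, HasDerivAt (fun x => s * x + z) s x := fun x => by
    simpa using ((hasDerivAt_id x).const_mul s).add_const z
  have hs' : 0 < |s| := abs_pos.2 hs
  refine mem_F3Bdd_of_hasDerivAt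
    (fun x => ((F3Bdd_hasDerivAt hf (s * x + z)).comp x (hd x)).const_mul _)
    (fun x => (((F3Bdd_hasDerivAt_deriv hf (s * x + z)).comp x (hd x)).mul_const s).const_mul _)
    (fun x y => ?_) ?_
  · have h := F3Bdd_iteratedDeriv_sub_le hf (s * x + z) (s * y + z)
    have e : s * x + z - (s * y + z) = s * (x - y) := by ring
    rw [e, abs_mul] at h
    rw [← mul_sub, ← sub_mul, ← sub_mul, abs_mul, abs_mul, abs_mul, abs_of_pos (by positivity)]
    -- Two factors `|s|` come from differentiating twice, the third from the Lipschitz bound.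
    calc _ ≤ (|s| ^ 3)⁻¹ * (|s| * |x - y| * |s| * |s|) := by gcongr
      _ = |x - y| := by field_simp
  · obtain ⟨C, hC⟩ := hf.2.2
    refine ⟨(|s| ^ 3)⁻¹ * C, fun x => ?_⟩
    rw [abs_mul, abs_of_pos (by positivity)]
    gcongr
    exact hC _

theorem F3Bdd_integrable {f : ℝ → ℝ} (hf : f ∈ F3Bdd) (ν : Measure ℝ) [IsFiniteMeasure ν] :
    Integrable f ν := by
  obtain ⟨C, hC⟩ := hf.2.2
  exact Integrable.of_bound hf.1.continuous.aestronglyMeasurable C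
    (Filter.Eventually.of_forall hC)

/-! ### Laws with finite third absolute moment -/

theorem integrable_of_abs_le_cube {ν : Measure ℝ} [IsFiniteMeasure ν]
    (h3 : Integrable (fun x : ℝ => |x| ^ 3) ν) {f : ℝ → ℝ} (hf : Continuous f) (C : ℝ)
    (hb : ∀ x, |f x| ≤ C * (1 + |x| ^ 3)) : Integrable f ν :=
  Integrable.mono' (((integrable_const 1).add h3).const_mul C) hf.aestronglyMeasurable
    (Filter.Eventually.of_forall hb)

theorem abs_le_one_add_cube (x : ℝ) : |x| ≤ 1 + |x| ^ 3 := by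
  nlinarith [abs_nonneg x, mul_nonneg (abs_nonneg x) (sq_nonneg (|x| - 1)), sq_nonneg (|x| - 1)]

theorem sq_le_one_add_cube (x : ℝ) : x ^ 2 ≤ 1 + |x| ^ 3 := by
  rw [← sq_abs]
  nlinarith [abs_nonneg x, mul_nonneg (abs_nonneg x) (sq_nonneg (|x| - 1)), sq_nonneg (|x| - 1)]

theorem abs_sub_cube_le (x t : ℝ) : |x - t| ^ 3 ≤ 4 * (1 + |t| ^ 3) * (1 + |x| ^ 3) := by
  have h1 : |x - t| ^ 3 ≤ (|x| + |t|) ^ 3 := by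
    gcongr
    exact abs_sub x t
  have h2 : (|x| + |t|) ^ 3 ≤ 4 * (|x| ^ 3 + |t| ^ 3) := by
    nlinarith [mul_nonneg (add_nonneg (abs_nonneg x) (abs_nonneg t)) (sq_nonneg (|x| - |t|))]
  have : 0 ≤ |t| ^ 3 * |x| ^ 3 := by positivity
  linarith

theorem max_zero_sq_le (y : ℝ) : max y 0 ^ 2 ≤ y ^ 2 := by
  rcases le_total y 0 with h | h
  · rw [max_eq_right h, zero_pow two_ne_zero]; positivity
  · rw [max_eq_left h]

theorem sub_sq_le_cube (x t : ℝ) : (x - t) ^ 2 ≤ 2 * (t ^ 2 + 1) * (1 + |x| ^ 3) := by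
  have : 0 ≤ |x| ^ 3 := by positivity
  nlinarith [sq_le_one_add_cube x, sq_nonneg (x + t), mul_nonneg (sq_nonneg t) this]

section Moments

variable {ν : Measure ℝ} [IsFiniteMeasure ν]

theorem integrable_id_of_cube (h3 : Integrable (fun x : ℝ => |x| ^ 3) ν) :
    Integrable (fun x : ℝ => x) ν :=
  integrable_of_abs_le_cube h3 continuous_id 1 fun x => by simpa using abs_le_one_add_cube x

theorem integrable_sq_of_cube (h3 : Integrable (fun x : ℝ => |x| ^ 3) ν) :
    Integrable (fun x : ℝ => x ^ 2) ν :=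
  integrable_of_abs_le_cube h3 (by fun_prop) 1 fun x => by
    simpa using sq_le_one_add_cube x

theorem integrable_sub_sq_of_cube (h3 : Integrable (fun x : ℝ => |x| ^ 3) ν)
    (t : ℝ) : Integrable (fun x : ℝ => (x - t) ^ 2) ν :=
  integrable_of_abs_le_cube h3 (by fun_prop) _ fun x => by
    simpa using sub_sq_le_cube x t

theorem integrable_abs_sub_cube (h3 : Integrable (fun x : ℝ => |x| ^ 3) ν)
    (t : ℝ) : Integrable (fun x : ℝ => |x - t| ^ 3) ν :=
  integrable_of_abs_le_cube h3 (by fun_prop) _ fun x => by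
    simpa using abs_sub_cube_le x t

theorem integrable_sub_cube (h3 : Integrable (fun x : ℝ => |x| ^ 3) ν)
    (t : ℝ) : Integrable (fun x : ℝ => (x - t) ^ 3) ν :=
  integrable_of_abs_le_cube h3 (by fun_prop) _ fun x => by
    simpa using abs_sub_cube_le x t

theorem integrable_max_sq (h3 : Integrable (fun x : ℝ => |x| ^ 3) ν)
    (t : ℝ) : Integrable (fun x : ℝ => max (x - t) 0 ^ 2) ν :=
  integrable_of_abs_le_cube h3 (by fun_prop) _ fun x => by
    rw [abs_of_nonneg (sq_nonneg _)]
    exact (max_zero_sq_le _).trans (sub_sq_le_cube x t)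

end Moments

/-- Standardized laws on the line with finite third absolute moment. -/
structure IsStandardLaw (ν : Measure ℝ) : Prop where
  isProb : IsProbabilityMeasure ν
  cube : Integrable (fun x : ℝ => |x| ^ 3) ν
  mean : ∫ x, x ∂ν = 0
  second : ∫ x, x ^ 2 ∂ν = 1

namespace IsStandardLaw

variable {ν : Measure ℝ}

theorem integrable_quadratic (hν : IsStandardLaw ν) (a b e : ℝ) :
    Integrable (fun x => a + b * x + e * x ^ 2) ν := by
  have := hν.isProb
  exact ((integrable_const a).add ((integrable_id_of_cube hν.cube).const_mul b)).add
    ((integrable_sq_of_cube hν.cube).const_mul e)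

/-- The value depends only on the coefficients: quadratics cannot distinguish `ν` from the symmetric
law on `±1`. -/
theorem integral_quadratic (hν : IsStandardLaw ν)
    (a b e : ℝ) : ∫ x, (a + b * x + e * x ^ 2) ∂ν = a + e := by
  have := hν.isProb
  have h1 : Integrable (fun x => a + b * x) ν :=
    (integrable_const a).add ((integrable_id_of_cube hν.cube).const_mul b)
  rw [integral_add h1 ((integrable_sq_of_cube hν.cube).const_mul e),
    integral_add (integrable_const a) ((integrable_id_of_cube hν.cube).const_mul b),
    integral_const_mul, integral_const_mul, hν.mean, hν.second]
  simp

theorem integral_quadratic_add (hν : IsStandardLaw ν)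
    (a b e : ℝ) {g : ℝ → ℝ} (hg : Integrable g ν) :
    ∫ x, (a + b * x + e * x ^ 2 + g x) ∂ν = a + e + ∫ x, g x ∂ν := by
  rw [integral_add (hν.integrable_quadratic a b e) hg, hν.integral_quadratic]

theorem map_neg (hν : IsStandardLaw ν) : IsStandardLaw (ν.map (fun x => -x)) := by
  have := hν.isProb
  have hm : Measurable (fun x : ℝ => -x) := measurable_neg
  refine ⟨Measure.isProbabilityMeasure_map hm.aemeasurable, ?_, ?_, ?_⟩
  · rw [integrable_map_measure (by fun_prop) hm.aemeasurable]
    simpa [Function.comp_def] using hν.cube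
  · rw [integral_map hm.aemeasurable (by fun_prop), integral_neg, hν.mean, neg_zero]
  · rw [integral_map hm.aemeasurable (by fun_prop)]
    simpa using hν.second

/-! ### Third absolute moments about a point, and the choice of knot -/

theorem one_le_cube (hν : IsStandardLaw ν) : 1 ≤ ∫ x, |x| ^ 3 ∂ν := by
  -- The right side is `(|x| - 1) ^ 2 * (|x| + 1 / 2)`.
  have h : ∀ x : ℝ, 0 ≤ 1 / 2 + 0 * x + (-3 / 2) * x ^ 2 + |x| ^ 3 := fun x => by
    rw [← sq_abs x]
    nlinarith [mul_nonneg (add_nonneg (abs_nonneg x) (by norm_num : (0 : ℝ) ≤ 1 / 2))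
      (sq_nonneg (|x| - 1))]
  have := integral_nonneg (μ := ν) (f := fun x => 1 / 2 + 0 * x + (-3 / 2) * x ^ 2 + |x| ^ 3) h
  rw [hν.integral_quadratic_add _ _ _ hν.cube] at this
  linarith

/-- Sharp bound for `∫ |x - t| ^ 3`, attained by the law on `-1 / c` and `c`. -/
theorem integral_abs_sub_cube_le_of_le (hν : IsStandardLaw ν)
    {c t : ℝ} (ht : 0 ≤ t) (htc : t ≤ c) (hc0 : 0 < c)
    (hc : c < 1) (hρ : ∫ x, |x| ^ 3 ∂ν ≤ 1 / c - c + 2 * c ^ 3 / (1 + c ^ 2)) :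
    ∫ x, |x - t| ^ 3 ∂ν ≤ t ^ 3 + 3 * t + (1 / c - c) + 2 * (c - t) ^ 3 / (1 + c ^ 2) := by
  have := hν.isProb
  obtain ⟨a, b, e, l, hl, hle, heq⟩ := exists_cubic_majorant ht htc hc0 hc
  have h1 : ∫ x, |x - t| ^ 3 ∂ν ≤ ∫ x, (a + b * x + e * x ^ 2 + l * |x| ^ 3) ∂ν :=
    integral_mono (integrable_abs_sub_cube hν.cube t)
      ((hν.integrable_quadratic a b e).add (hν.cube.const_mul l)) hle
  rw [hν.integral_quadratic_add _ _ _ (hν.cube.const_mul l), integral_const_mul] at h1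
  linarith [mul_le_mul_of_nonneg_left hρ hl]

/-- The slack is `1 + 3 t ^ 2 - (t ^ 3 + 3 t) = (1 - t) ^ 3`. For `t ≤ c` it absorbs `2 (c - t) ^ 3
/ (1 + c ^ 2)`; larger `t` reduces to `t = c`. -/
theorem integral_abs_sub_cube_le_of_param (hν : IsStandardLaw ν)
    {c t : ℝ} (ht : 0 ≤ t) (ht1 : t ≤ 1) (hc0 : 0 < c)
    (hc : c < 1) (hρ : ∫ x, |x| ^ 3 ∂ν ≤ 1 / c - c + 2 * c ^ 3 / (1 + c ^ 2)) :
    ∫ x, |x - t| ^ 3 ∂ν ≤ 1 + 3 * t ^ 2 + (1 / c - c) := by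
  have := hν.isProb
  have h1t : 0 ≤ (1 - t) ^ 3 := pow_nonneg (by linarith) 3
  rcases le_total t c with htc | htc
  · refine (hν.integral_abs_sub_cube_le_of_le ht htc hc0 hc hρ).trans ?_
    have h1 : 2 * (c - t) ^ 3 / (1 + c ^ 2) ≤ (1 - t) ^ 3 := by
      rw [div_le_iff₀ (by positivity)]
      have h2 : c - t ≤ c * (1 - t) := by nlinarith
      have h3 : (c - t) ^ 3 ≤ (c * (1 - t)) ^ 3 := by
        have := sub_nonneg.2 htc
        gcongr
      have h4 : 2 * c ^ 3 ≤ 1 + c ^ 2 := by nlinarith [pow_pos hc0 2]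
      nlinarith [mul_le_mul_of_nonneg_left h4 h1t]
    nlinarith
  -- The quadratic is `(t - x) ^ 3 - (c - x) ^ 3`, so equality holds for `x ≤ c`.
  · have h1 : ∀ x, |x - t| ^ 3 ≤
        (t ^ 3 - c ^ 3) + (-3 * (t ^ 2 - c ^ 2)) * x + 3 * (t - c) * x ^ 2 + |x - c| ^ 3 := by
      intro x
      rcases le_total x c with hx | hx
      · rw [abs_of_nonpos (by linarith), abs_of_nonpos (by linarith)]
        apply le_of_eq; ring
      rw [abs_of_nonneg (sub_nonneg.2 hx)]
      rcases le_total x t with hxt | hxt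
      · rw [abs_of_nonpos (by linarith)]
        have : 0 ≤ (x - c) ^ 3 := pow_nonneg (by linarith) 3
        nlinarith
      · rw [abs_of_nonneg (by linarith)]
        have : (x - t) ^ 3 ≤ (x - c) ^ 3 := by
          have := sub_nonneg.2 hxt
          gcongr
        nlinarith
    have h2 := integral_mono (integrable_abs_sub_cube hν.cube t)
      ((hν.integrable_quadratic _ _ _).add (integrable_abs_sub_cube hν.cube c)) h1
    rw [show ((fun x => (t ^ 3 - c ^ 3) + (-3 * (t ^ 2 - c ^ 2)) * x + 3 * (t - c) * x ^ 2) +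
      fun x => |x - c| ^ 3) = fun x => (t ^ 3 - c ^ 3) + (-3 * (t ^ 2 - c ^ 2)) * x +
      3 * (t - c) * x ^ 2 + |x - c| ^ 3 from rfl,
      hν.integral_quadratic_add _ _ _ (integrable_abs_sub_cube hν.cube c)] at h2
    have h3 := hν.integral_abs_sub_cube_le_of_le hc0.le le_rfl hc0 hc hρ
    simp only [sub_self, ne_eq, OfNat.ofNat_ne_zero, not_false_eq_true, zero_pow, mul_zero,
      zero_div, add_zero] at h3
    nlinarith

theorem integral_abs_sub_cube_le_of_nonneg (hν : IsStandardLaw ν)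
    {t : ℝ} (ht : 0 ≤ t) (ht1 : t ≤ 1) :
    ∫ x, |x - t| ^ 3 ∂ν ≤ 1 + 3 * t ^ 2 + B (∫ x, |x| ^ 3 ∂ν) := by
  rcases eq_or_lt_of_le hν.one_le_cube with h | h
  · have hB : B 1 = 0 := by
      have := B_sub_two_div (R := 2) (by norm_num)
      norm_num at this
      exact this
    rw [← h, hB]
    -- `ρ = 1` corresponds to the excluded value `c = 1`. Every `c ∈ (0, 1)` has parametrized moment
    -- at least `1`, so the bound holds for all of them and passes to the limit.
    have hlim : Filter.Tendsto (fun c : ℝ => 1 + 3 * t ^ 2 + (1 / c - c)) (nhdsWithin 1 (Set.Iio 1))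
        (nhds (1 + 3 * t ^ 2 + 0)) := by
      have : ContinuousAt (fun c : ℝ => 1 + 3 * t ^ 2 + (1 / c - c)) 1 := by
        fun_prop (disch := norm_num)
      simpa using this.tendsto.mono_left nhdsWithin_le_nhds
    refine ge_of_tendsto hlim ?_
    filter_upwards [Ioo_mem_nhdsLT (show (0 : ℝ) < 1 by norm_num)] with c hc
    refine hν.integral_abs_sub_cube_le_of_param ht ht1 hc.1 hc.2 (h.symm.trans_le ?_)
    have hc0 := hc.1
    have : 1 / c - c + 2 * c ^ 3 / (1 + c ^ 2) = (1 + c ^ 4) / (c * (1 + c ^ 2)) := by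
      field_simp; ring
    rw [this, one_le_div (by positivity)]
    have h1 : 0 ≤ (1 - c) * (1 - c ^ 3) :=
      mul_nonneg (by linarith [hc.2]) (by linarith [pow_le_one₀ (n := 3) hc0.le hc.2.le])
    nlinarith
  · obtain ⟨c, hc0, hc1, hρ, hB⟩ := exists_two_point_parameter h
    rw [hB]
    exact hν.integral_abs_sub_cube_le_of_param ht ht1 hc0 hc1 hρ.le

theorem integral_abs_sub_cube_le (hν : IsStandardLaw ν) {t : ℝ} (ht : -1 ≤ t) (ht1 : t ≤ 1) :
    ∫ x, |x - t| ^ 3 ∂ν ≤ 1 + 3 * t ^ 2 + B (∫ x, |x| ^ 3 ∂ν) := by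
  rcases le_total 0 t with h | h
  · exact hν.integral_abs_sub_cube_le_of_nonneg h ht1
  · have := hν.map_neg.integral_abs_sub_cube_le_of_nonneg (t := -t) (by linarith) (by linarith)
    rw [integral_map measurable_neg.aemeasurable (by fun_prop),
      integral_map measurable_neg.aemeasurable (by fun_prop)] at this
    simp only [abs_neg, even_two, Even.neg_pow] at this
    refine (le_of_eq ?_).trans this
    congr 1 with x
    rw [← abs_neg]
    congr 2
    ring

/-- The knot at which the truncated second moments of `ν` and of the symmetric law on `±1`
agree. -/
theorem exists_knot (hν : IsStandardLaw ν) :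
    ∃ t ∈ Set.Icc (-1 : ℝ) 1, ∫ x, max (x - t) 0 ^ 2 ∂ν = (1 - t) ^ 2 / 2 := by
  have := hν.isProb
  have hcont : ContinuousOn (fun t => ∫ x, max (x - t) 0 ^ 2 ∂ν) (Set.Icc (-1 : ℝ) 1) := by
    refine continuousOn_of_dominated (bound := fun x => 2 + 0 * x + 2 * x ^ 2)
      (fun t _ => by fun_prop) (fun t ht => Filter.Eventually.of_forall fun x => ?_)
      (hν.integrable_quadratic _ _ _) (Filter.Eventually.of_forall fun x => by fun_prop)
    rw [Real.norm_of_nonneg (sq_nonneg _)]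
    refine (max_zero_sq_le _).trans ?_
    have : t ^ 2 ≤ 1 := by nlinarith [ht.1, ht.2]
    nlinarith [sq_nonneg (x + t)]
  have hcont' : ContinuousOn (fun t => ∫ x, max (x - t) 0 ^ 2 ∂ν - (1 - t) ^ 2 / 2)
      (Set.Icc (-1 : ℝ) 1) := hcont.sub (by fun_prop)
  -- At `t = -1` the integral is at most `∫ (x + 1) ^ 2 = 2`, the symmetric value; at `t = 1` it is
  -- at least `0`, again the symmetric value.
  have h1 := integral_mono (integrable_max_sq hν.cube (-1)) (hν.integrable_quadratic 1 2 1)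
    (fun x => (max_zero_sq_le _).trans (le_of_eq (by ring)))
  rw [hν.integral_quadratic] at h1
  have h2 : 0 ≤ ∫ x, max (x - 1) 0 ^ 2 ∂ν := integral_nonneg fun x => sq_nonneg _
  obtain ⟨t, ht, h⟩ := intermediate_value_Icc (by norm_num) hcont'
    (show (0 : ℝ) ∈ Set.Icc _ _ from ⟨by linarith, by simpa using h2⟩)
  exact ⟨t, ht, by linarith [h]⟩

end IsStandardLaw

/-! ### Comparison of a standardized law with the symmetric law on `±1` -/

theorem hasDerivAt_max_zero_sq (y : ℝ) :
    HasDerivAt (fun y : ℝ => max y 0 ^ 2) (2 * max y 0) y := by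
  rcases lt_trichotomy y 0 with h | rfl | h
  · rw [max_eq_right h.le, mul_zero]
    refine (hasDerivAt_const y (0 : ℝ)).congr_of_eventuallyEq ?_
    filter_upwards [Iio_mem_nhds h] with z hz
    rw [max_eq_right (le_of_lt hz), zero_pow two_ne_zero]
  · have : (fun y : ℝ => max y 0 ^ 2) =O[nhds 0] fun x => ‖x - 0‖ ^ 2 :=
      Asymptotics.IsBigO.of_bound 1 (Filter.Eventually.of_forall fun x => by
        simpa using max_zero_sq_le x)
    simpa using (this.hasFDerivAt (by norm_num)).hasDerivAt
  · rw [max_eq_left h.le]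
    refine (by simpa using hasDerivAt_pow 2 y : HasDerivAt (fun y => y ^ 2) (2 * y)
      y).congr_of_eventuallyEq ?_
    filter_upwards [Ioi_mem_nhds h] with z hz
    rw [max_eq_left (le_of_lt hz)]

theorem hasDerivAt_abs_cube (y : ℝ) :
    HasDerivAt (fun y : ℝ => |y| ^ 3) (3 * (|y| * y)) y := by
  have h := hasDerivAt_abs_rpow y (p := 3) (by norm_num)
  have e : ((3 : ℝ) - 2) = 1 := by norm_num
  rw [e, Real.rpow_one] at h
  simpa [mul_assoc] using (by exact_mod_cast h : HasDerivAt (fun y : ℝ => |y| ^ 3) (3 * |y| * y) y)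

/-- Since `f''` is `1`-Lipschitz, `x - f'' x` is nondecreasing. The free affine term accommodates
the derivative of the interpolant on one side of the knot. -/
theorem F3Bdd_convexOn_deriv {f : ℝ → ℝ} (hf : f ∈ F3Bdd) (t α β : ℝ) :
    ConvexOn ℝ Set.univ (fun x => (x - t) ^ 2 / 2 - deriv f x - (α + β * x)) := by
  have hd : ∀ x, HasDerivAt (fun x => (x - t) ^ 2 / 2 - deriv f x - (α + β * x))
      ((x - t) - iteratedDeriv 2 f x - β) x := fun x => by
    have h1 : HasDerivAt (fun x => (x - t) ^ 2 / 2) (x - t) x := by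
      have := (((hasDerivAt_id x).sub_const t).pow 2).div_const 2
      simpa using this
    have h2 : HasDerivAt (fun x => α + β * x) β x := by
      simpa using ((hasDerivAt_id x).const_mul β).const_add α
    exact (h1.sub (F3Bdd_hasDerivAt_deriv hf x)).sub h2
  refine Monotone.convexOn_univ_of_deriv (fun x => (hd x).differentiableAt) fun x y hxy => ?_
  rw [(hd x).deriv, (hd y).deriv]
  have := (abs_le.1 (F3Bdd_iteratedDeriv_sub_le hf y x)).2
  rw [abs_of_nonneg (sub_nonneg.2 hxy)] at this
  linarith

theorem F3Bdd_concaveOn_deriv {f : ℝ → ℝ} (hf : f ∈ F3Bdd) (t α β : ℝ) :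
    ConcaveOn ℝ Set.univ (fun x => -((x - t) ^ 2 / 2) - deriv f x - (α + β * x)) := by
  have h := (F3Bdd_convexOn_deriv (F3Bdd_neg hf) t (-α) (-β)).neg
  refine h.congr fun x _ => ?_
  simp only [Pi.neg_apply, deriv.fun_neg]
  ring

namespace IsStandardLaw

variable {ν : Measure ℝ}

/-- Among the test functions, those of the form `|x - t| ^ 3 / 6` are extremal: the case of an
interior knot. -/
theorem integral_sub_le_of_knot (hν : IsStandardLaw ν)
    {f : ℝ → ℝ} (hf : f ∈ F3Bdd) {t : ℝ} (ht : -1 < t) (ht1 : t < 1)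
    (hknot : ∫ x, max (x - t) 0 ^ 2 ∂ν = (1 - t) ^ 2 / 2) :
    ∫ x, f x ∂ν - (f 1 + f (-1)) / 2 ≤ (∫ x, |x - t| ^ 3 ∂ν - (1 + 3 * t ^ 2)) / 6 := by
  have := hν.isProb
  set s := 1 - t with hs
  have hs0 : 0 < s := by linarith
  have hst : 0 < s * (1 + t) := mul_pos hs0 (by linarith)
  set g1 := (1 - t) ^ 3 / 6 - f 1 with hg1
  set gm := (1 + t) ^ 3 / 6 - f (-1) with hgm
  set g1' := (1 - t) ^ 2 / 2 - deriv f 1 with hg1'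
  set gm' := -(1 + t) ^ 2 / 2 - deriv f (-1) with hgm'
  -- Hermite interpolation at `±1` by `1, x, x ^ 2, (x - t)₊ ^ 2`. Eliminating `a, b, e` leaves `d`
  -- with coefficient `(1 - t) * (1 + t)`, nonzero because the knot is interior.
  obtain ⟨d, hd⟩ : ∃ d, d * (s * (1 + t)) = g1' + gm' - (g1 - gm) :=
    ⟨(g1' + gm' - (g1 - gm)) / (s * (1 + t)), div_mul_cancel₀ _ hst.ne'⟩
  obtain ⟨b, hb⟩ : ∃ b, 2 * b + d * s ^ 2 = g1 - gm :=
    ⟨(g1 - gm - d * s ^ 2) / 2, by ring⟩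
  obtain ⟨e, he⟩ : ∃ e, b - 2 * e = gm' := ⟨(b - gm') / 2, by ring⟩
  obtain ⟨a, ha⟩ : ∃ a, a - b + e = gm := ⟨gm + b - e, by ring⟩
  have e1 : a + b + e + d * s ^ 2 = g1 := by linarith
  have e2 : b + 2 * e + 2 * d * s = g1' := by
    have : s * (1 + t) = 2 * s - s ^ 2 := by rw [hs]; ring
    rw [this] at hd
    linarith
  set G : ℝ → ℝ := fun x =>
    |x - t| ^ 3 / 6 - f x - (a + b * x + e * x ^ 2 + d * max (x - t) 0 ^ 2) with hG
  set h : ℝ → ℝ := fun x =>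
    |x - t| * (x - t) / 2 - deriv f x - (b + 2 * e * x + 2 * d * max (x - t) 0) with hh
  have hder : ∀ x, HasDerivAt G (h x) x := by
    intro x
    have hx : HasDerivAt (fun x => x - t) 1 x := (hasDerivAt_id x).sub_const t
    have d1 := ((hasDerivAt_abs_cube (x - t)).comp x hx).div_const 6
    have d2 := ((hasDerivAt_max_zero_sq (x - t)).comp x hx).const_mul d
    have d3 : HasDerivAt (fun x => a + b * x + e * x ^ 2) (b + 2 * e * x) x := by
      have := (((hasDerivAt_id x).const_mul b).const_add a).add
        ((hasDerivAt_pow 2 x).const_mul e)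
      exact this.congr_deriv (by simp; ring)
    refine ((d1.sub (F3Bdd_hasDerivAt hf x)).sub (d3.add d2)).congr_deriv ?_
    simp only [hh]
    ring
  have hconv : ConvexOn ℝ (Set.Ici t) h := by
    refine ((F3Bdd_convexOn_deriv hf t (b - 2 * d * t) (2 * e + 2 * d)).subset
      (Set.subset_univ _) (convex_Ici t)).congr fun x hx => ?_
    have hx : 0 ≤ x - t := sub_nonneg.2 hx
    simp only [hh]
    rw [abs_of_nonneg hx, max_eq_left hx]
    ring
  have hconc : ConcaveOn ℝ (Set.Iic t) h := by
    refine ((F3Bdd_concaveOn_deriv hf t b (2 * e)).subset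
      (Set.subset_univ _) (convex_Iic t)).congr fun x hx => ?_
    have hx : x - t ≤ 0 := sub_nonpos.2 hx
    simp only [hh]
    rw [abs_of_nonpos hx, max_eq_right hx]
    ring
  have a1 : |1 - t| = s := abs_of_pos hs0
  have m1 : max (1 - t) 0 = s := max_eq_left hs0.le
  have am : |-1 - t| = 1 + t := by rw [abs_of_neg (by linarith)]; ring
  have mm : max (-1 - t) 0 = 0 := max_eq_right (by linarith)
  have hpos := nonneg_of_convexOn_deriv ht ht1 hder hconv hconc
    (by simp only [hh, a1, m1]; linarith [e2, hg1'])
    (by simp only [hh, am, mm]; linarith [he, hgm'])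
    (by simp only [hG, a1, m1]; linarith [e1, hg1])
    (by simp only [hG, am, mm]; linarith [ha, hgm])
  have hint := integral_nonneg (μ := ν) (f := G) hpos
  have i1 := (integrable_abs_sub_cube hν.cube t).div_const 6
  have i2 := F3Bdd_integrable hf ν
  have i3 := (integrable_max_sq hν.cube t).const_mul d
  have i4 : Integrable (fun x => |x - t| ^ 3 / 6 - f x) ν := i1.sub i2
  have i5 : Integrable (fun x => a + b * x + e * x ^ 2 + d * max (x - t) 0 ^ 2) ν :=
    (hν.integrable_quadratic a b e).add i3
  simp only [hG] at hint
  rw [integral_sub i4 i5, integral_sub i1 i2, hν.integral_quadratic_add a b e i3,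
    integral_div, integral_const_mul, hknot] at hint
  -- By the knot equation the interpolant integrates to `a + e + d * s ^ 2 / 2 = (g1 + gm) / 2`, its
  -- mean under the symmetric law.
  nlinarith

/-- Among the test functions, those of the form `|x - t| ^ 3 / 6` are extremal: the case of a law
supported in `(-∞, 1]`. -/
theorem integral_sub_le_of_ae_le_one (hν : IsStandardLaw ν)
    {f : ℝ → ℝ} (hf : f ∈ F3Bdd) (hle : ∀ᵐ x ∂ν, x ≤ 1) :
    ∫ x, f x ∂ν - (f 1 + f (-1)) / 2 ≤ (∫ x, |x - 1| ^ 3 ∂ν - 4) / 6 := by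
  have := hν.isProb
  set g1 := - f 1 with hg1
  set gm := 8 / 6 - f (-1) with hgm
  set gm' := -2 - deriv f (-1) with hgm'
  -- With no mass beyond `1`, the derivative at `1` need not be matched: a quadratic meets the other
  -- three conditions.
  obtain ⟨b, hb⟩ : ∃ b, 2 * b = g1 - gm := ⟨(g1 - gm) / 2, by ring⟩
  obtain ⟨e, he⟩ : ∃ e, b - 2 * e = gm' := ⟨(b - gm') / 2, by ring⟩
  obtain ⟨a, ha⟩ : ∃ a, a - b + e = gm := ⟨gm + b - e, by ring⟩
  set G : ℝ → ℝ := fun x => -((x - 1) ^ 3 / 6) - f x - (a + b * x + e * x ^ 2) with hG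
  set h : ℝ → ℝ := fun x => -((x - 1) ^ 2 / 2) - deriv f x - (b + 2 * e * x) with hh
  have hder : ∀ x, HasDerivAt G (h x) x := by
    intro x
    have d1 := ((((hasDerivAt_id x).sub_const 1).pow 3).div_const 6).neg
    have d3 : HasDerivAt (fun x => a + b * x + e * x ^ 2) (b + 2 * e * x) x := by
      have := (((hasDerivAt_id x).const_mul b).const_add a).add
        ((hasDerivAt_pow 2 x).const_mul e)
      exact this.congr_deriv (by simp; ring)
    refine ((d1.sub (F3Bdd_hasDerivAt hf x)).sub d3).congr_deriv ?_
    simp only [hh, id]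
    ring
  have hconc : ConcaveOn ℝ (Set.Iic 1) h :=
    (F3Bdd_concaveOn_deriv hf 1 b (2 * e)).subset (Set.subset_univ _) (convex_Iic 1)
  have hpos : ∀ᵐ x ∂ν, 0 ≤ |x - 1| ^ 3 / 6 - f x - (a + b * x + e * x ^ 2) := by
    filter_upwards [hle] with x hx
    have := nonneg_of_concaveOn_deriv hder hconc
      (by simp only [hh]; linarith [he, hgm'])
      (by simp only [hG]; linarith [hg1])
      (by simp only [hG]; linarith [ha, hgm]) hx
    simp only [hG] at this
    rw [abs_of_nonpos (by linarith)]
    linarith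
  have hint := integral_nonneg_of_ae hpos
  have i1 := (integrable_abs_sub_cube hν.cube 1).div_const 6
  have i2 := F3Bdd_integrable hf ν
  have i4 : Integrable (fun x => |x - 1| ^ 3 / 6 - f x) ν := i1.sub i2
  rw [integral_sub i4 (hν.integrable_quadratic a b e), integral_sub i1 i2,
    hν.integral_quadratic, integral_div] at hint
  linarith

theorem integral_sub_le (hν : IsStandardLaw ν) {f : ℝ → ℝ} (hf : f ∈ F3Bdd) :
    ∫ x, f x ∂ν - (f 1 + f (-1)) / 2 ≤ B (∫ x, |x| ^ 3 ∂ν) / 6 := by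
  have := hν.isProb
  obtain ⟨t, ht, hknot⟩ := hν.exists_knot
  rcases eq_or_lt_of_le ht.2 with rfl | ht2
  · have hae : ∀ᵐ x ∂ν, x ≤ 1 := by
      rw [sub_self, zero_pow two_ne_zero, zero_div, integral_eq_zero_iff_of_nonneg
        (fun x => sq_nonneg _) (integrable_max_sq hν.cube 1)] at hknot
      filter_upwards [hknot] with x hx
      have : max (x - 1) 0 = 0 := by simpa using hx
      linarith [max_eq_right_iff.1 this]
    have h1 := hν.integral_sub_le_of_ae_le_one hf hae
    have h2 := hν.integral_abs_sub_cube_le (t := 1) (by norm_num) le_rfl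
    linarith
  rcases eq_or_lt_of_le ht.1 with rfl | ht1
  · have i2 := integrable_max_sq hν.cube (-1)
    -- The knot equation at `-1` says that `(x + 1) ^ 2 - (x + 1)₊ ^ 2 ≥ 0` has integral zero.
    -- Reflection then gives a law on `(-∞, 1]`.
    have hae : ∀ᵐ x ∂ν, -1 ≤ x := by
      have h0 : ∫ x, (1 + 2 * x + 1 * x ^ 2 - max (x - -1) 0 ^ 2) ∂ν = 0 := by
        rw [integral_sub (hν.integrable_quadratic 1 2 1) i2, hν.integral_quadratic, hknot]
        norm_num
      have i3 : Integrable (fun x => 1 + 2 * x + 1 * x ^ 2 - max (x - -1) 0 ^ 2) ν :=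
        (hν.integrable_quadratic 1 2 1).sub i2
      rw [integral_eq_zero_iff_of_nonneg (fun x => by
        have := max_zero_sq_le (x - -1)
        simp only [Pi.zero_apply]
        linarith) i3] at h0
      filter_upwards [h0] with x hx
      simp only [Pi.zero_apply] at hx
      by_contra hc
      push Not at hc
      rw [max_eq_right (by linarith)] at hx
      nlinarith
    have hf' : (fun x => f (-x)) ∈ F3Bdd := by
      simpa using F3Bdd_comp_affine hf (s := -1) (by norm_num) 0
    have hae' : ∀ᵐ x ∂(ν.map (fun x => -x)), x ≤ 1 := by
      rw [ae_map_iff measurable_neg.aemeasurable measurableSet_Iic]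
      filter_upwards [hae] with x hx
      linarith
    have h1 := hν.map_neg.integral_sub_le_of_ae_le_one hf' hae'
    have h2 := hν.map_neg.integral_abs_sub_cube_le (t := 1) (by norm_num) le_rfl
    rw [integral_map measurable_neg.aemeasurable hf'.1.continuous.aestronglyMeasurable] at h1
    have e3 : ∫ x, |x| ^ 3 ∂(ν.map (fun x => -x)) = ∫ x, |x| ^ 3 ∂ν := by
      rw [integral_map measurable_neg.aemeasurable (by fun_prop)]
      simp
    rw [e3] at h2
    simp only [neg_neg] at h1
    linarith
  · have h1 := hν.integral_sub_le_of_knot hf ht1 ht2 hknot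
    have h2 := hν.integral_abs_sub_cube_le ht.1 ht.2
    linarith

theorem abs_integral_sub_le (hν : IsStandardLaw ν) {f : ℝ → ℝ} (hf : f ∈ F3Bdd) :
    |∫ x, f x ∂ν - (f 1 + f (-1)) / 2| ≤ B (∫ x, |x| ^ 3 ∂ν) / 6 := by
  have h1 := hν.integral_sub_le hf
  have h2 := hν.integral_sub_le (F3Bdd_neg hf)
  rw [integral_neg] at h2
  exact abs_le.2 ⟨by linarith, h1⟩

end IsStandardLaw

/-! ### Standardization -/

theorem variance_id_eq_integral (P : Measure ℝ) :
    ProbabilityTheory.variance id P = ∫ x, (x - mean P) ^ 2 ∂P :=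
  ProbabilityTheory.variance_eq_integral aemeasurable_id

theorem stdDev_sq (P : Measure ℝ) : stdDev P ^ 2 = ∫ x, (x - mean P) ^ 2 ∂P := by
  rw [stdDev, Real.sq_sqrt (ProbabilityTheory.variance_nonneg _ _), variance_id_eq_integral]

theorem integral_standardize (P : Measure ℝ) {f : ℝ → ℝ} (hf : Continuous f) :
    ∫ x, f x ∂(standardize P) = ∫ x, f ((x - mean P) / stdDev P) ∂P := by
  rw [standardize, integral_map (by fun_prop) hf.aestronglyMeasurable]

theorem integral_sub_mean {P : Measure ℝ} [IsProbabilityMeasure P]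
    (h3 : Integrable (fun x : ℝ => |x| ^ 3) P) : ∫ x, (x - mean P) ∂P = 0 := by
  rw [integral_sub (integrable_id_of_cube h3) (integrable_const _)]
  simp [mean]

theorem isStandardLaw_standardize {P : Measure ℝ} (hP : MemP3 P) :
    IsStandardLaw (standardize P) := by
  have := hP.isProbabilityMeasure
  have h3 := hP.integrable_abs_pow_three
  have hs := hP.stdDev_pos
  have hm : AEMeasurable (fun x => (x - mean P) / stdDev P) P := by fun_prop
  refine ⟨Measure.isProbabilityMeasure_map hm, ?_, ?_, ?_⟩
  · rw [standardize, integrable_map_measure (by fun_prop) hm]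
    refine ((integrable_abs_sub_cube h3 (mean P)).div_const (stdDev P ^ 3)).congr
      (Filter.Eventually.of_forall fun x => ?_)
    simp only [Function.comp_apply]
    rw [abs_div, div_pow, abs_of_pos hs]
  · rw [integral_standardize P (f := fun x => x) continuous_id, integral_div,
      integral_sub_mean h3, zero_div]
  · rw [integral_standardize P (by fun_prop)]
    simp only [div_pow]
    rw [integral_div, ← stdDev_sq, div_self (by positivity)]

theorem integral_cube_standardize (P : Measure ℝ) :
    ∫ x, x ^ 3 ∂(standardize P) = centredThirdMoment P / stdDev P ^ 3 := by
  rw [integral_standardize P (by fun_prop), centredThirdMoment]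
  simp only [div_pow]
  rw [integral_div]

/-! ### Two-point laws -/

theorem integral_two_point {p : ℝ} (hp : 0 ≤ p) (hp1 : p ≤ 1) (a b : ℝ) (f : ℝ → ℝ) :
    ∫ x, f x ∂(ENNReal.ofReal p • Measure.dirac a + ENNReal.ofReal (1 - p) • Measure.dirac b) =
      p * f a + (1 - p) * f b := by
  rw [integral_add_measure
    ((integrable_dirac (by simp)).smul_measure ENNReal.ofReal_ne_top)
    ((integrable_dirac (by simp)).smul_measure ENNReal.ofReal_ne_top)]
  simp [integral_smul_measure, ENNReal.toReal_ofReal, hp, hp1]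

theorem symmTwoPoint_eq (s : ℝ) : symmTwoPoint s =
    ENNReal.ofReal (1 / 2) • Measure.dirac (-s) +
      ENNReal.ofReal (1 - 1 / 2) • Measure.dirac s := by
  have : ENNReal.ofReal (1 / 2) = 2⁻¹ := by
    rw [one_div, ENNReal.ofReal_inv_of_pos (by norm_num)]; simp
  rw [symmTwoPoint, smul_add, show (1 : ℝ) - 1 / 2 = 1 / 2 by norm_num, this]

theorem integral_symmTwoPoint (s : ℝ) (f : ℝ → ℝ) :
    ∫ x, f x ∂(symmTwoPoint s) = (f s + f (-s)) / 2 := by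
  rw [symmTwoPoint_eq, integral_two_point (by norm_num) (by norm_num)]
  ring

theorem isProbabilityMeasure_symmTwoPoint (s : ℝ) : IsProbabilityMeasure (symmTwoPoint s) := by
  constructor
  simp only [symmTwoPoint, Measure.smul_apply, Measure.add_apply, measure_univ, smul_eq_mul]
  rw [one_add_one_eq_two, ENNReal.inv_mul_cancel (by simp) (by simp)]

theorem integrable_symmTwoPoint (s : ℝ) (f : ℝ → ℝ) : Integrable f (symmTwoPoint s) :=
  ((integrable_dirac (by simp)).add_measure (integrable_dirac (by simp))).smul_measure (by simp)

theorem mean_symmTwoPoint (s : ℝ) : mean (symmTwoPoint s) = 0 := by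
  rw [mean, integral_symmTwoPoint s fun x => x]; ring

theorem stdDev_symmTwoPoint {s : ℝ} (hs : 0 ≤ s) : stdDev (symmTwoPoint s) = s := by
  rw [stdDev, variance_id_eq_integral, mean_symmTwoPoint,
    integral_symmTwoPoint s fun x => (x - 0) ^ 2,
    Real.sqrt_eq_iff_mul_self_eq (by positivity) hs]
  ring

theorem centredThirdMoment_symmTwoPoint (s : ℝ) : centredThirdMoment (symmTwoPoint s) = 0 := by
  rw [centredThirdMoment, mean_symmTwoPoint, integral_symmTwoPoint s fun x => (x - 0) ^ 3]
  ring

theorem rho_eq {P : Measure ℝ} (hs : 0 < stdDev P) :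
    rho P = (∫ x, |x - mean P| ^ 3 ∂P) / stdDev P ^ 3 := by
  rw [rho, integral_standardize P (by fun_prop), ← integral_div]
  simp only [abs_div, div_pow, abs_of_pos hs]

/-- The bound of the theorem is sharp for two-point laws. -/
theorem abs_centredThirdMoment_of_isTwoPoint {P : Measure ℝ} (hP : IsTwoPoint P) :
    |centredThirdMoment P| = stdDev P ^ 3 * B (rho P) := by
  obtain ⟨a, b, p, hab, hp, hp1, hPe⟩ := hP
  have I : ∀ f : ℝ → ℝ, ∫ x, f x ∂P = p * f a + (1 - p) * f b := fun f => by
    rw [hPe, integral_two_point hp.le hp1.le]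
  have hq : 0 < 1 - p := by linarith
  have hm : mean P = p * a + (1 - p) * b := I fun x => x
  have ea : a - mean P = (1 - p) * (a - b) := by rw [hm]; ring
  have eb : b - mean P = -(p * (a - b)) := by rw [hm]; ring
  have hD : 0 < |a - b| := abs_pos.2 (sub_ne_zero.2 hab)
  set D := |a - b| with hDdef
  set w := √(p * (1 - p)) with hw
  have hpq : 0 < p * (1 - p) := mul_pos hp hq
  have hw0 : 0 < w := Real.sqrt_pos.2 hpq
  have hww : w ^ 2 = p * (1 - p) := Real.sq_sqrt hpq.le
  have hs : stdDev P = w * D := by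
    rw [stdDev, variance_id_eq_integral, I fun x => (x - mean P) ^ 2, ea, eb,
      Real.sqrt_eq_iff_mul_self_eq (by positivity) (by positivity), ← sq, mul_pow w D, hww, hDdef,
      sq_abs]
    ring
  have hs0 : 0 < stdDev P := by rw [hs]; positivity
  have hthird : centredThirdMoment P = p * (1 - p) * (1 - 2 * p) * (a - b) ^ 3 := by
    rw [centredThirdMoment, I fun x => (x - mean P) ^ 3, ea, eb]
    ring
  have habs : ∫ x, |x - mean P| ^ 3 ∂P = p * (1 - p) * (1 - 2 * (p * (1 - p))) * D ^ 3 := by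
    rw [I fun x => |x - mean P| ^ 3, ea, eb, abs_neg, abs_mul, abs_mul, abs_of_pos hp,
      abs_of_pos hq]
    ring
  -- `ρ = (1 - 2 * w ^ 2) / w` has the form `R - 2 / R` with `R = 1 / w`, for which `B` is explicit.
  have hrho : rho P = 1 / w - 2 / (1 / w) := by
    rw [rho_eq hs0, habs, hs, ← hww]
    field_simp
  have hB : √((1 / w) ^ 2 - 4) = |1 - 2 * p| / w := by
    have : (1 / w) ^ 2 - 4 = ((1 - 2 * p) / w) ^ 2 := by
      rw [div_pow, div_pow, hww]
      field_simp
      ring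
    rw [this, Real.sqrt_sq_eq_abs, abs_div, abs_of_pos hw0]
  rw [hrho, B_sub_two_div (by positivity), hB, hthird, hs, abs_mul, abs_mul, abs_pow,
    abs_of_pos hpq, ← hww, ← hDdef]
  field_simp

/-! ### Convolutions -/

theorem abs_integral_sub_le_of_forall {μ : Measure ℝ} [IsProbabilityMeasure μ] {u v : ℝ → ℝ}
    (hu : Integrable u μ) (hv : Integrable v μ) {C : ℝ} (h : ∀ x, |u x - v x| ≤ C) :
    |∫ x, u x ∂μ - ∫ x, v x ∂μ| ≤ C := by
  rw [← integral_sub hu hv]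
  simpa using norm_integral_le_of_norm_le_const (μ := μ) (f := fun x => u x - v x)
    (Filter.Eventually.of_forall h)

theorem F3Bdd_comp_add {f : ℝ → ℝ} (hf : f ∈ F3Bdd) (z : ℝ) : (fun x => f (x + z)) ∈ F3Bdd := by
  simpa using F3Bdd_comp_affine hf one_ne_zero z

theorem isProbabilityMeasure_convFin : ∀ (n : ℕ) (P : Fin n → Measure ℝ),
    (∀ i, IsProbabilityMeasure (P i)) → IsProbabilityMeasure (convFin n P)
  | 0, _, _ => by unfold convFin; infer_instance
  | n + 1, P, h => by
    have := h 0
    have := isProbabilityMeasure_convFin n (fun i => P i.succ) fun i => h i.succ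
    unfold convFin
    infer_instance

/-- Replacing the factors of a convolution one at a time. -/
theorem abs_integral_convFin_sub_le : ∀ (n : ℕ) (P Q : Fin n → Measure ℝ) (m C : Fin n → ℝ),
    (∀ i, IsProbabilityMeasure (P i)) → (∀ i, IsProbabilityMeasure (Q i)) →
    (∀ i, ∀ f ∈ F3Bdd, |∫ x, f (x - m i) ∂(P i) - ∫ x, f x ∂(Q i)| ≤ C i) →
    ∀ f ∈ F3Bdd, |∫ x, f (x - ∑ i, m i) ∂(convFin n P) - ∫ x, f x ∂(convFin n Q)| ≤ ∑ i, C i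
  | 0, P, Q, m, C, _, _, _, f, _ => by simp [convFin]
  | n + 1, P, Q, m, C, hP, hQ, h, f, hf => by
    have := hP 0
    have := hQ 0
    have := isProbabilityMeasure_convFin n (fun i => P i.succ) fun i => hP i.succ
    have := isProbabilityMeasure_convFin n (fun i => Q i.succ) fun i => hQ i.succ
    have ih := abs_integral_convFin_sub_le n (fun i => P i.succ) (fun i => Q i.succ)
      (fun i => m i.succ) (fun i => C i.succ) (fun i => hP i.succ) (fun i => hQ i.succ)
      fun i => h i.succ
    simp only [convFin, Fin.sum_univ_succ]
    set U := convFin n fun i => P i.succ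
    set T := convFin n fun i => Q i.succ
    set M := ∑ i : Fin n, m i.succ
    have hfc := hf.1.continuous
    obtain ⟨K, hK⟩ := hf.2.2
    have hprod : ∀ (μ ν : Measure ℝ) [IsProbabilityMeasure μ] [IsProbabilityMeasure ν] (z : ℝ),
        Integrable (fun q : ℝ × ℝ => f (q.1 + q.2 + z)) (μ.prod ν) := fun μ ν _ _ z =>
      Integrable.of_bound (by fun_prop) K (Filter.Eventually.of_forall fun q => hK _)
    have hconv : ∀ (μ ν : Measure ℝ) [IsProbabilityMeasure μ] [IsProbabilityMeasure ν] (z : ℝ),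
        ∫ x, f (x + z) ∂(μ.conv ν) = ∫ x, ∫ y, f (x + y + z) ∂ν ∂μ := fun μ ν _ _ z =>
      integral_conv (F3Bdd_integrable (F3Bdd_comp_add hf z) _)
    have e1 : ∫ x, f (x - (m 0 + M)) ∂((P 0).conv U) =
        ∫ x, ∫ y, f (x + y + -(m 0 + M)) ∂U ∂(P 0) := by
      rw [← hconv]; simp only [sub_eq_add_neg]
    have e2 : ∫ x, f x ∂((Q 0).conv T) = ∫ y, ∫ x, f (x + y + 0) ∂(Q 0) ∂T := by
      have := hconv (Q 0) T 0
      simp only [add_zero] at this ⊢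
      rw [this]
      refine integral_integral_swap ?_
      simpa [Function.uncurry_def] using hprod (Q 0) T 0
    have e3 : ∫ x, ∫ y, f (x + y + -m 0) ∂T ∂(P 0) = ∫ y, ∫ x, f (x + y + -m 0) ∂(P 0) ∂T :=
      integral_integral_swap (hprod (P 0) T (-m 0))
    rw [e1, e2]
    -- The intermediate law is `P 0 ∗ T`, shifted by `-m 0`. Freezing `x` exchanges the tail by
    -- induction; freezing `y` in `b2` exchanges the first factor.
    have b1 : |∫ x, ∫ y, f (x + y + -(m 0 + M)) ∂U ∂(P 0) -
        ∫ x, ∫ y, f (x + y + -m 0) ∂T ∂(P 0)| ≤ ∑ i : Fin n, C i.succ := by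
      refine abs_integral_sub_le_of_forall (hprod (P 0) U _).integral_prod_left
        (hprod (P 0) T _).integral_prod_left fun x => ?_
      convert ih _ (F3Bdd_comp_add hf (x - m 0)) using 5 with y y
      · ring_nf
      · ring_nf
    have b2 : |∫ y, ∫ x, f (x + y + -m 0) ∂(P 0) ∂T - ∫ y, ∫ x, f (x + y + 0) ∂(Q 0) ∂T| ≤ C 0 := by
      refine abs_integral_sub_le_of_forall (hprod (P 0) T _).integral_prod_right
        (hprod (Q 0) T _).integral_prod_right fun y => ?_
      convert h 0 _ (F3Bdd_comp_add hf y) using 5 with x x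
      · ring_nf
      · ring_nf
    rw [e3] at b1
    rw [add_comm (C 0)]
    exact (abs_sub_le _ _ _).trans (add_le_add b1 b2)

section Conv

variable {μ ν : Measure ℝ} [IsProbabilityMeasure μ] [IsProbabilityMeasure ν]

theorem integrable_cube_conv (hμ : Integrable (fun x : ℝ => |x| ^ 3) μ)
    (hν : Integrable (fun x : ℝ => |x| ^ 3) ν) : Integrable (fun x : ℝ => |x| ^ 3) (μ.conv ν) := by
  unfold Measure.conv
  rw [integrable_map_measure (by fun_prop) (by fun_prop)]
  have h1 : Integrable (fun x : ℝ => 4 * (1 + |x| ^ 3)) μ :=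
    ((integrable_const 1).add hμ).const_mul 4
  have h2 : Integrable (fun x : ℝ => 1 + |x| ^ 3) ν := (integrable_const 1).add hν
  refine (h1.mul_prod h2).mono' (by fun_prop) (Filter.Eventually.of_forall fun q => ?_)
  have := abs_sub_cube_le q.2 (-q.1)
  simp only [Function.comp_apply, norm_pow, Real.norm_eq_abs, abs_abs]
  rw [abs_neg, sub_neg_eq_add, add_comm q.2] at this
  exact this

theorem integral_conv_of_abs_le_cube (hμ : Integrable (fun x : ℝ => |x| ^ 3) μ)
    (hν : Integrable (fun x : ℝ => |x| ^ 3) ν) {f : ℝ → ℝ} (hf : Continuous f) (C : ℝ)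
    (hb : ∀ x, |f x| ≤ C * (1 + |x| ^ 3)) :
    ∫ x, f x ∂(μ.conv ν) = ∫ x, ∫ y, f (x + y) ∂ν ∂μ :=
  integral_conv (integrable_of_abs_le_cube (integrable_cube_conv hμ hν) hf C hb)

theorem mean_conv (hμ : Integrable (fun x : ℝ => |x| ^ 3) μ)
    (hν : Integrable (fun x : ℝ => |x| ^ 3) ν) : mean (μ.conv ν) = mean μ + mean ν := by
  rw [mean, integral_conv_of_abs_le_cube hμ hν (f := fun x => x) continuous_id 1
    fun x => by simpa using abs_le_one_add_cube x]
  have h1 : ∀ x : ℝ, ∫ y, (x + y) ∂ν = x + mean ν := fun x => by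
    rw [integral_add (integrable_const _) (integrable_id_of_cube hν)]
    simp [mean]
  simp only [h1]
  rw [integral_add (integrable_id_of_cube hμ) (integrable_const _)]
  simp [mean]

theorem variance_conv (hμ : Integrable (fun x : ℝ => |x| ^ 3) μ)
    (hν : Integrable (fun x : ℝ => |x| ^ 3) ν) : ProbabilityTheory.variance id (μ.conv ν) =
    ProbabilityTheory.variance id μ + ProbabilityTheory.variance id ν := by
  simp only [variance_id_eq_integral]
  rw [mean_conv hμ hν, integral_conv_of_abs_le_cube hμ hν
    (f := fun x => (x - (mean μ + mean ν)) ^ 2) (by fun_prop) _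
    fun x => by simpa using sub_sq_le_cube x (mean μ + mean ν)]
  have iμ := integrable_sub_sq_of_cube hμ (mean μ)
  have iν := integrable_sub_sq_of_cube hν (mean ν)
  have i1 : Integrable (fun x => x - mean ν) ν :=
    (integrable_id_of_cube hν).sub (integrable_const _)
  have h1 : ∀ x : ℝ, ∫ y, (x + y - (mean μ + mean ν)) ^ 2 ∂ν =
      (x - mean μ) ^ 2 + ∫ y, (y - mean ν) ^ 2 ∂ν := fun x => by
    have e : ∀ y, (x + y - (mean μ + mean ν)) ^ 2 =
        (x - mean μ) ^ 2 + 2 * (x - mean μ) * (y - mean ν) + (y - mean ν) ^ 2 := fun y => by ring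
    simp only [e]
    have i2 : Integrable (fun y => (x - mean μ) ^ 2 + 2 * (x - mean μ) * (y - mean ν)) ν :=
      (integrable_const _).add (i1.const_mul _)
    rw [integral_add i2 iν, integral_add (integrable_const _) (i1.const_mul _),
      integral_const_mul, integral_sub_mean hν]
    simp
  simp only [h1]
  rw [integral_add iμ (integrable_const _)]
  simp

theorem centredThirdMoment_conv (hμ : Integrable (fun x : ℝ => |x| ^ 3) μ)
    (hν : Integrable (fun x : ℝ => |x| ^ 3) ν) :
    centredThirdMoment (μ.conv ν) = centredThirdMoment μ + centredThirdMoment ν := by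
  simp only [centredThirdMoment]
  rw [mean_conv hμ hν, integral_conv_of_abs_le_cube hμ hν
    (f := fun x => (x - (mean μ + mean ν)) ^ 3) (by fun_prop) _
    fun x => by simpa using abs_sub_cube_le x (mean μ + mean ν)]
  have jμ := integrable_sub_cube hμ (mean μ)
  have jν := integrable_sub_cube hν (mean ν)
  have iν := integrable_sub_sq_of_cube hν (mean ν)
  have i1 : Integrable (fun x => x - mean ν) ν :=
    (integrable_id_of_cube hν).sub (integrable_const _)
  have i1' : Integrable (fun x => x - mean μ) μ :=
    (integrable_id_of_cube hμ).sub (integrable_const _)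
  set v := ∫ y, (y - mean ν) ^ 2 ∂ν with hv
  set w := ∫ y, (y - mean ν) ^ 3 ∂ν with hw
  have h1 : ∀ x : ℝ, ∫ y, (x + y - (mean μ + mean ν)) ^ 3 ∂ν =
      (x - mean μ) ^ 3 + (3 * v * (x - mean μ) + w) := fun x => by
    have e : ∀ y, (x + y - (mean μ + mean ν)) ^ 3 =
        (x - mean μ) ^ 3 + 3 * (x - mean μ) ^ 2 * (y - mean ν) +
          (3 * (x - mean μ) * (y - mean ν) ^ 2 + (y - mean ν) ^ 3) := fun y => by ring
    simp only [e]
    have i2 : Integrable (fun y => (x - mean μ) ^ 3 + 3 * (x - mean μ) ^ 2 * (y - mean ν)) ν :=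
      (integrable_const _).add (i1.const_mul _)
    have i3 : Integrable (fun y => 3 * (x - mean μ) * (y - mean ν) ^ 2 + (y - mean ν) ^ 3) ν :=
      (iν.const_mul _).add jν
    rw [integral_add i2 i3, integral_add (integrable_const _) (i1.const_mul _),
      integral_add (iν.const_mul _) jν, integral_const_mul, integral_const_mul,
      integral_sub_mean hν, ← hv, ← hw]
    simp
    ring
  simp only [h1]
  have i4 : Integrable (fun x => 3 * v * (x - mean μ) + w) μ :=
    (i1'.const_mul _).add (integrable_const _)
  rw [integral_add jμ i4, integral_add (i1'.const_mul _) (integrable_const _),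
    integral_const_mul, integral_sub_mean hμ]
  simp

end Conv

/-- Mean, variance and centred third moment are additive under convolution. -/
theorem convFin_moments : ∀ (n : ℕ) (P : Fin n → Measure ℝ),
    (∀ i, IsProbabilityMeasure (P i)) → (∀ i, Integrable (fun x : ℝ => |x| ^ 3) (P i)) →
    Integrable (fun x : ℝ => |x| ^ 3) (convFin n P) ∧
    mean (convFin n P) = ∑ i, mean (P i) ∧
    ProbabilityTheory.variance id (convFin n P) = ∑ i, ProbabilityTheory.variance id (P i) ∧
    centredThirdMoment (convFin n P) = ∑ i, centredThirdMoment (P i)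
  | 0, _, _, _ => by
    refine ⟨integrable_dirac (by simp), ?_, ?_, ?_⟩ <;> simp [convFin, mean, centredThirdMoment]
  | n + 1, P, hP, h3 => by
    have := hP 0
    have := isProbabilityMeasure_convFin n (fun i => P i.succ) fun i => hP i.succ
    obtain ⟨i3, im, iv, it⟩ := convFin_moments n (fun i => P i.succ) (fun i => hP i.succ)
      fun i => h3 i.succ
    simp only [convFin, Fin.sum_univ_succ]
    rw [← im, ← iv, ← it]
    exact ⟨integrable_cube_conv (h3 0) i3, mean_conv (h3 0) i3, variance_conv (h3 0) i3,
      centredThirdMoment_conv (h3 0) i3⟩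

/-! ### Upper and lower bounds for the Zolotarev distance -/

/-- A law with finite third moment, compared with the symmetric two-point law of the same
variance. -/
theorem abs_integral_sub_symmTwoPoint_le {P : Measure ℝ} (hP : MemP3 P) {f : ℝ → ℝ}
    (hf : f ∈ F3Bdd) :
    |∫ x, f (x - mean P) ∂P - ∫ x, f x ∂(symmTwoPoint (stdDev P))| ≤
      stdDev P ^ 3 * B (rho P) / 6 := by
  have hs := hP.stdDev_pos
  have hg := F3Bdd_comp_affine hf hs.ne' 0
  have key := (isStandardLaw_standardize hP).abs_integral_sub_le hg
  rw [integral_standardize P hg.1.continuous, ← rho] at key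
  have e : ∀ x, stdDev P * ((x - mean P) / stdDev P) = x - mean P := fun x => by field_simp
  simp only [e, add_zero, mul_one, mul_neg, abs_of_pos hs] at key
  rw [integral_const_mul] at key
  rw [integral_symmTwoPoint]
  have e2 : (stdDev P ^ 3)⁻¹ * ∫ x, f (x - mean P) ∂P -
      ((stdDev P ^ 3)⁻¹ * f (stdDev P) + (stdDev P ^ 3)⁻¹ * f (-stdDev P)) / 2 =
      (stdDev P ^ 3)⁻¹ * (∫ x, f (x - mean P) ∂P - (f (stdDev P) + f (-stdDev P)) / 2) := by ring
  rw [e2, abs_mul, abs_of_pos (by positivity), inv_mul_le_iff₀ (by positivity)] at key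
  linarith

/-- Bounded substitutes for the cube: for small `ε` this is `x ^ 3 / 6 - x / ε ^ 2` up to `O(ε ^ 2)`
at fixed `x`, and the divergent linear term vanishes under centred laws. -/
theorem F3Bdd_sin {ε : ℝ} (hε : 0 < ε) : (fun x => -Real.sin (ε * x) / ε ^ 3) ∈ F3Bdd := by
  have hd : ∀ x, HasDerivAt (fun x => ε * x) ε x := fun x => by
    simpa using (hasDerivAt_id x).const_mul ε
  refine mem_F3Bdd_of_hasDerivAt (f' := fun x => -Real.cos (ε * x) / ε ^ 2)
    (f'' := fun x => Real.sin (ε * x) / ε) (fun x => ?_) (fun x => ?_) (fun x y => ?_) ?_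
  · refine (((Real.hasDerivAt_sin (ε * x)).comp x (hd x)).neg.div_const (ε ^ 3)).congr_deriv ?_
    field_simp
  · refine (((Real.hasDerivAt_cos (ε * x)).comp x (hd x)).neg.div_const (ε ^ 2)).congr_deriv ?_
    field_simp
  · rw [← sub_div, abs_div, abs_of_pos hε, div_le_iff₀ hε]
    have := Real.lipschitzWith_sin.dist_le_mul (ε * x) (ε * y)
    rw [Real.dist_eq, Real.dist_eq, ← mul_sub, abs_mul, abs_of_pos hε] at this
    simpa [mul_comm] using this
  · refine ⟨1 / ε ^ 3, fun x => ?_⟩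
    rw [abs_div, abs_neg, abs_of_pos (pow_pos hε 3)]
    gcongr
    exact Real.abs_sin_le_one _

theorem tendsto_sub_sin_div_cube (x : ℝ) :
    Filter.Tendsto (fun ε : ℝ => (ε * x - Real.sin (ε * x)) / ε ^ 3) (nhdsWithin 0 (Set.Ioi 0))
      (nhds (x ^ 3 / 6)) := by
  rw [tendsto_iff_norm_sub_tendsto_zero]
  have hlim : Filter.Tendsto (fun ε : ℝ => ε ^ 2 * |x| ^ 5 / 100) (nhdsWithin 0 (Set.Ioi 0))
      (nhds 0) := by
    have : ContinuousAt (fun ε : ℝ => ε ^ 2 * |x| ^ 5 / 100) 0 := by fun_prop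
    simpa using this.tendsto.mono_left nhdsWithin_le_nhds
  have hsmall : ∀ᶠ ε : ℝ in nhdsWithin 0 (Set.Ioi 0), |ε * x| ≤ 1 := by
    have : ContinuousAt (fun ε : ℝ => |ε * x|) 0 := by fun_prop
    have h := this.tendsto.mono_left (nhdsWithin_le_nhds (s := Set.Ioi 0))
    simp only [zero_mul, abs_zero] at h
    exact h.eventually_le_const one_pos
  refine squeeze_zero' (Filter.Eventually.of_forall fun _ => norm_nonneg _) ?_ hlim
  filter_upwards [hsmall, self_mem_nhdsWithin] with ε h1 hε
  have hε : 0 < ε := hε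
  have hb := Real.sin_bound h1
  have e : (ε * x - Real.sin (ε * x)) / ε ^ 3 - x ^ 3 / 6 =
      -(Real.sin (ε * x) - (ε * x - (ε * x) ^ 3 / 6)) / ε ^ 3 := by
    field_simp
    ring
  rw [e, Real.norm_eq_abs, abs_div, abs_neg, abs_of_pos (pow_pos hε 3), div_le_iff₀ (pow_pos hε 3)]
  refine hb.trans (le_of_eq ?_)
  rw [abs_mul, abs_of_pos hε]
  ring

/-- The Zolotarev distance of order `3` dominates the difference of third moments. -/
theorem ofReal_abs_cube_sub_le_zeta3 {ν₁ ν₂ : Measure ℝ} (h₁ : IsStandardLaw ν₁)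
    (h₂ : IsStandardLaw ν₂) :
    ENNReal.ofReal (|∫ x, x ^ 3 ∂ν₁ - ∫ x, x ^ 3 ∂ν₂| / 6) ≤ zeta3 ν₁ ν₂ := by
  have hlim : ∀ {ν : Measure ℝ}, IsStandardLaw ν →
      Filter.Tendsto (fun ε : ℝ => ∫ x, -Real.sin (ε * x) / ε ^ 3 ∂ν) (nhdsWithin 0 (Set.Ioi 0))
        (nhds ((∫ x, x ^ 3 ∂ν) / 6)) := by
    intro ν hν
    have := hν.isProb
    -- Adding the linear term, which has integral zero, makes the integrand converge and be
    -- dominated by `|x| ^ 3 / 6`.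
    have h := tendsto_integral_filter_of_dominated_convergence (μ := ν)
      (F := fun (ε : ℝ) x => (ε * x - Real.sin (ε * x)) / ε ^ 3) (f := fun x => x ^ 3 / 6)
      (l := nhdsWithin 0 (Set.Ioi 0)) (fun x => |x| ^ 3 / 6)
      (Filter.Eventually.of_forall fun ε => by fun_prop) ?_ (hν.cube.div_const 6)
      (Filter.Eventually.of_forall tendsto_sub_sin_div_cube)
    · rw [integral_div] at h
      refine h.congr' ?_
      filter_upwards [self_mem_nhdsWithin] with ε hε
      have i1 : Integrable (fun x => ε * x / ε ^ 3) ν :=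
        ((integrable_id_of_cube hν.cube).const_mul ε).div_const _
      have e : ∀ x, (ε * x - Real.sin (ε * x)) / ε ^ 3 =
          ε * x / ε ^ 3 + -Real.sin (ε * x) / ε ^ 3 := fun x => by ring
      simp only [e]
      rw [integral_add i1 (F3Bdd_integrable (F3Bdd_sin hε) ν), integral_div, integral_const_mul,
        hν.mean]
      simp
    · filter_upwards [self_mem_nhdsWithin] with ε hε
      have hε : 0 < ε := hε
      refine Filter.Eventually.of_forall fun x => ?_
      rw [Real.norm_eq_abs, abs_div, abs_of_pos (pow_pos hε 3), div_le_iff₀ (pow_pos hε 3)]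
      refine (Real.abs_sub_sin_le (ε * x)).trans (le_of_eq ?_)
      rw [abs_mul, abs_of_pos hε]
      ring
  have h := ENNReal.tendsto_ofReal ((hlim h₁).sub (hlim h₂)).abs
  rw [← sub_div, abs_div, abs_of_pos (by norm_num : (0 : ℝ) < 6)] at h
  refine le_of_tendsto h ?_
  filter_upwards [self_mem_nhdsWithin] with ε hε
  exact le_iSup₂ (f := fun f (_ : f ∈ F3Bdd) =>
    ENNReal.ofReal |(∫ x, f x ∂ν₁) - ∫ x, f x ∂ν₂|) _ (F3Bdd_sin hε)

/-! ### The upper bound and the equality case combined -/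

theorem theorem1p8 (n : ℕ) (hn : 1 ≤ n) (P : Fin n → Measure ℝ) (hP : ∀ i, MemP3 (P i))
    (σ : ℝ) (hσ : σ = √(∑ i, stdDev (P i) ^ 2)) :
    zeta3 (standardize (convFin n P))
        (standardize (convFin n (fun i => symmTwoPoint (stdDev (P i)))))
      ≤ ENNReal.ofReal (1 / (6 * σ ^ 3) * ∑ i, stdDev (P i) ^ 3 * B (rho (P i))) ∧
    ((∀ i, IsTwoPoint (P i)) →
      ((∀ i, 0 ≤ centredThirdMoment (P i)) ∨ (∀ i, centredThirdMoment (P i) ≤ 0)) →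
      zeta3 (standardize (convFin n P))
          (standardize (convFin n (fun i => symmTwoPoint (stdDev (P i)))))
        = ENNReal.ofReal (1 / (6 * σ ^ 3) * ∑ i, stdDev (P i) ^ 3 * B (rho (P i)))) := by
  have hs := fun i => (hP i).stdDev_pos
  have hPp := fun i => (hP i).isProbabilityMeasure
  set Q : Fin n → Measure ℝ := fun i => symmTwoPoint (stdDev (P i)) with hQ
  have hQp : ∀ i, IsProbabilityMeasure (Q i) := fun i => isProbabilityMeasure_symmTwoPoint _
  obtain ⟨Pc, Pm, Pv, Pt⟩ := convFin_moments n P hPp fun i => (hP i).integrable_abs_pow_three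
  obtain ⟨Qc, Qm, Qv, Qt⟩ := convFin_moments n Q hQp fun i => integrable_symmTwoPoint _ _
  have hvar : ∀ R : Measure ℝ, ProbabilityTheory.variance id R = stdDev R ^ 2 := fun R => by
    rw [stdDev_sq, variance_id_eq_integral]
  have Pσ : stdDev (convFin n P) = σ := by
    rw [hσ, stdDev, Pv]
    simp only [hvar]
  have Qσ : stdDev (convFin n Q) = σ := by
    rw [hσ, stdDev, Qv]
    simp only [hvar, hQ, stdDev_symmTwoPoint (hs _).le]
  have hσ0 : 0 < σ := by
    rw [hσ, Real.sqrt_pos]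
    exact Finset.sum_pos (fun i _ => pow_pos (hs i) 2) ⟨⟨0, hn⟩, Finset.mem_univ _⟩
  replace Qm : mean (convFin n Q) = 0 := by
    rw [Qm]
    simp only [hQ, mean_symmTwoPoint, Finset.sum_const_zero]
  replace Qt : centredThirdMoment (convFin n Q) = 0 := by
    rw [Qt]
    simp only [hQ, centredThirdMoment_symmTwoPoint, Finset.sum_const_zero]
  have upper : zeta3 (standardize (convFin n P)) (standardize (convFin n Q)) ≤
      ENNReal.ofReal (1 / (6 * σ ^ 3) * ∑ i, stdDev (P i) ^ 3 * B (rho (P i))) := by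
    refine iSup₂_le fun f hf => ENNReal.ofReal_le_ofReal ?_
    -- The function `σ ^ 3 * f (x / σ)` moves the standardization of the sums onto the test
    -- function.
    have hg := F3Bdd_comp_affine hf (inv_ne_zero hσ0.ne') 0
    have key := abs_integral_convFin_sub_le n P Q (fun i => mean (P i)) _ hPp hQp
      (fun i f hf => abs_integral_sub_symmTwoPoint_le (hP i) hf) _ hg
    simp only [add_zero, abs_of_pos (inv_pos.2 hσ0), inv_pow, inv_inv] at key
    rw [integral_const_mul, integral_const_mul, ← mul_sub, abs_mul, abs_of_pos (pow_pos hσ0 3),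
      ← Finset.sum_div] at key
    rw [integral_standardize _ hf.1.continuous, integral_standardize _ hf.1.continuous, Pσ, Qσ,
      Pm, Qm]
    simp only [sub_zero, div_eq_inv_mul _ σ]
    rw [one_div, inv_mul_eq_div, le_div_iff₀ (by positivity)]
    linarith
  refine ⟨upper, fun h2 hsign => le_antisymm upper ?_⟩
  have memP : MemP3 (convFin n P) :=
    ⟨isProbabilityMeasure_convFin n P hPp, Pc, Pσ.symm ▸ hσ0⟩
  have memQ : MemP3 (convFin n Q) :=
    ⟨isProbabilityMeasure_convFin n Q hQp, Qc, Qσ.symm ▸ hσ0⟩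
  refine le_trans (le_of_eq ?_) (ofReal_abs_cube_sub_le_zeta3 (isStandardLaw_standardize memP)
    (isStandardLaw_standardize memQ))
  -- The common sign turns the sum of moduli into the modulus of the sum.
  have habs : ∑ i, stdDev (P i) ^ 3 * B (rho (P i)) = |∑ i, centredThirdMoment (P i)| := by
    simp only [← abs_centredThirdMoment_of_isTwoPoint (h2 _)]
    rcases hsign with h | h
    · rw [abs_of_nonneg (Finset.sum_nonneg fun i _ => h i)]
      exact Finset.sum_congr rfl fun i _ => abs_of_nonneg (h i)
    · rw [abs_of_nonpos (Finset.sum_nonpos fun i _ => h i), ← Finset.sum_neg_distrib]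
      exact Finset.sum_congr rfl fun i _ => abs_of_nonpos (h i)
  rw [integral_cube_standardize, integral_cube_standardize, Qt, Pσ, Pt, habs, zero_div, sub_zero,
    abs_div, abs_of_pos (pow_pos hσ0 3)]
  congr 1
  field_simp
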